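/- **Theorem 3.1.** Let $n\ge 1$ be an integer, let $p,q>1$ be real, let $K\subset\mathbb{R}^n$ be a convex body (a compact convex set) containing the origin in its interior, with support function $h_K(v)=\max\{\langle v,y\rangle: y\in K\}$, and let $f:\mathbb{S}^{n-1}\to\mathbb{R}$ be continuous. Here $s^p$ is the usual power for $s\ge 0$, and for $s<0$ it denotes $|s|^p\cos(\pi p)$, the real part of its principal value (the usual power when $p$ is an integer). For a measurable set $L\subset\mathbb{R}^n$ let the Gaussian dual quermassintegral be $$\widetilde V_{\gamma_n,q}(L)=\int_L e^{-|x|^2/2}|x|^{q-n}\,dx ,$$ with $dx$ Lebesgue measure, and for $h:\mathbb{S}^{n-1}\to(0,\infty)$ let $[h]=\{x\in\mathbb{R}^n:\langle x,v\rangle\le h(v)\text{ for all }v\in\mathbb{S}^{n-1}\}$ be its Wulff shape. Let $\partial'K$ be the set of boundary points $x$ of $K$ with a unique outer unit normal $\nu_K(x)$, let $\nu_K:\partial'K\to\mathbb{S}^{n-1}$ be the Gauss map, and define the $L_p$ Gaussian dual curvature measure of $K$ on Borel sets $\eta\subset\mathbb{S}^{n-1}$ by $$\widetilde C_{p,\gamma_n,q}(K,\eta)=\int_{\nu_K^{-1}(\eta)}\langle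 x,\nu_K(x)\rangle^{1-p}\,|x|^{q-n}e^{-|x|^2/2}\,d\mathcal{H}^{n-1}(x),$$ where $\mathcal{H}^{n-1}$ is the $(n-1)$-dimensional Hausdorff measure with its usual normalization. Then there is $\delta>0$ such that for every $t\in(-\delta,\delta)$ the function $h_K^p+tf^p$ is positive on $\mathbb{S}^{n-1}$ and the Wulff shape $[h_t]$ of $h_t=(h_K^p+tf^p)^{1/p}$ is a convex body containing the origin in its interior, with $\widetilde V_{\gamma_n,q}([h_t])<\infty$. Moreover $\widetilde V_{\gamma_n,q}(K)<\infty$, the function $f^p$ is integrable with respect to $\widetilde C_{p,\gamma_n,q}(K,\cdot)$, and $$\lim_{t\to0}\frac{\widetilde V_{\gamma_n,q}([h_t])-\widetilde V_{\gamma_n,q}(K)}{t}=\frac1p\int_{\mathbb{S}^{n-1}}f(v)^p\,d\widetilde C_{p,\gamma_n,q}(K,v).$$ -/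

import Mathlib

open MeasureTheory Filter Topology Set

namespace GaussDual

/-- Euclidean space `ℝⁿ`. -/
abbrev E (n : ℕ) : Type := EuclideanSpace ℝ (Fin n)

/-- The unit sphere `𝕊ⁿ⁻¹` of `ℝⁿ`. -/
abbrev S (n : ℕ) : Type := Metric.sphere (0 : E n) 1

/-- The support function `h_K(x) = max {⟨x, y⟩ : y ∈ K}`
(the supremum is attained when `K` is compact and nonempty). -/
noncomputable def supportFun {n : ℕ} (K : Set (E n)) (x : E n) : ℝ :=
  sSup ((fun y => inner ℝ x y) '' K)

/-- The Wulff shape `[h] = {x : ⟨x, v⟩ ≤ h(v) for all v ∈ 𝕊ⁿ⁻¹}`. -/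
def wulffShape {n : ℕ} (h : S n → ℝ) : Set (E n) :=
  {x | ∀ v : S n, inner ℝ x (v : E n) ≤ h v}

/-- The function `h_t = (h_K ^ p + t f ^ p) ^ (1/p)` on the sphere. -/
noncomputable def lpPerturbation {n : ℕ} (p : ℝ) (K : Set (E n)) (f : S n → ℝ) (t : ℝ) :
    S n → ℝ :=
  fun v => (supportFun K v ^ p + t * f v ^ p) ^ (1 / p)

/-- The density `e^{-|x|²/2} |x|^{q-n}` on `ℝⁿ`. -/
noncomputable def gaussKernel {n : ℕ} (q : ℝ) (x : E n) : ℝ :=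
  Real.exp (-‖x‖ ^ 2 / 2) * ‖x‖ ^ (q - n)

/-- The Gaussian dual quermassintegral `∫_K e^{-|x|²/2} |x|^{q-n} dx` (Lebesgue measure). -/
noncomputable def gaussDualQuermass {n : ℕ} (q : ℝ) (K : Set (E n)) : ℝ :=
  ∫ x in K, gaussKernel q x

/-- `v` is an outer unit normal of `K` at `x`: the point `x` lies on the supporting hyperplane
`H_K(v) = {x : ⟨x, v⟩ = h_K(v)}`. -/
def IsOuterNormal {n : ℕ} (K : Set (E n)) (x : E n) (v : S n) : Prop :=
  inner ℝ x (v : E n) = supportFun K v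

/-- The regular boundary `∂'K`: the boundary points with exactly one outer unit normal. -/
def regularBoundary {n : ℕ} (K : Set (E n)) : Set (E n) :=
  {x | x ∈ frontier K ∧ ∃! v : S n, IsOuterNormal K x v}

/-- The Gauss map `ν_K : ∂'K → 𝕊ⁿ⁻¹`. -/
noncomputable def gaussMap {n : ℕ} (K : Set (E n)) (x : regularBoundary K) : S n :=
  x.2.2.choose

/-- The measure `𝓗ⁿ⁻¹` on `∂'K`. Here `μHE[d]` is the Hausdorff measure with the usual
normalization, for which it agrees with Lebesgue measure on `ℝᵈ`. -/
noncomputable def boundaryMeasure {n : ℕ} (K : Set (E n)) : Measure (regularBoundary K) :=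
  Measure.comap Subtype.val (μHE[n - 1] : Measure (E n))

/-- The `L_p` Gaussian dual curvature measure on the sphere,
`η ↦ ∫_{ν_K⁻¹(η)} ⟨x, ν_K(x)⟩^{1-p} |x|^{q-n} e^{-|x|²/2} d𝓗ⁿ⁻¹(x)`, as the image under `ν_K`
of the measure on `∂'K` with this density; see `lpGaussDualCurvature_apply`. -/
noncomputable def lpGaussDualCurvature {n : ℕ} (p q : ℝ) (K : Set (E n)) : Measure (S n) :=
  Measure.map (gaussMap K) ((boundaryMeasure K).withDensity fun x =>
    ENNReal.ofReal (inner ℝ (x : E n) (gaussMap K x : E n) ^ (1 - p) * gaussKernel q (x : E n)))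

lemma gaussMap_spec {n : ℕ} (K : Set (E n)) (x : regularBoundary K) :
    IsOuterNormal K x (gaussMap K x) :=
  x.2.2.choose_spec.1

lemma eq_gaussMap {n : ℕ} (K : Set (E n)) (x : regularBoundary K) {v : S n}
    (hv : IsOuterNormal K x v) : v = gaussMap K x :=
  x.2.2.choose_spec.2 v hv

lemma le_supportFun {n : ℕ} {K : Set (E n)} (hK : IsCompact K) (x : E n) {y : E n} (hy : y ∈ K) :
    inner ℝ x y ≤ supportFun K x :=
  le_csSup (hK.image (by fun_prop)).bddAbove ⟨y, hy, rfl⟩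

/-- On boundary points of a compact set, being an outer normal is a closed condition. -/
lemma isOuterNormal_iff {n : ℕ} {K : Set (E n)} (hK : IsCompact K) {x : E n} (hx : x ∈ K)
    (v : S n) : IsOuterNormal K x v ↔ ∀ y ∈ K, inner ℝ (v : E n) y ≤ inner ℝ x (v : E n) := by
  unfold IsOuterNormal
  constructor
  · intro h y hy
    rw [h]
    exact le_supportFun hK _ hy
  · intro h
    apply le_antisymm
    · rw [real_inner_comm]
      exact le_supportFun hK _ hx
    · apply csSup_le (Set.Nonempty.image _ ⟨x, hx⟩)
      rintro _ ⟨y, hy, rfl⟩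
      exact h y hy

lemma isClosed_normals {n : ℕ} {K : Set (E n)} (hK : IsCompact K) :
    IsClosed {z : E n × S n | z.1 ∈ frontier K ∧ IsOuterNormal K z.1 z.2} := by
  have h : {z : E n × S n | z.1 ∈ frontier K ∧ IsOuterNormal K z.1 z.2} =
      {z | z.1 ∈ frontier K} ∩
        {z | ∀ y ∈ K, inner ℝ (z.2 : E n) y ≤ inner ℝ z.1 (z.2 : E n)} := by
    ext z
    simp only [mem_ofPred_eq, mem_inter_iff]
    exact and_congr_right fun hz => isOuterNormal_iff hK (hK.isClosed.frontier_subset hz) _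
  rw [h]
  refine (isClosed_frontier.preimage continuous_fst).inter ?_
  simp only [ofPred_forall]
  exact isClosed_iInter fun y => isClosed_iInter fun _ => isClosed_le (by fun_prop) (by fun_prop)

lemma isCompact_normals {n : ℕ} {K : Set (E n)} (hK : IsCompact K) :
    IsCompact {z : E n × S n | z.1 ∈ frontier K ∧ IsOuterNormal K z.1 z.2} :=
  (hK.prod isCompact_univ).of_isClosed_subset (isClosed_normals hK)
    fun _ hz => ⟨hK.isClosed.frontier_subset hz.1, mem_univ _⟩

lemma measurableSet_regularBoundary {n : ℕ} {K : Set (E n)} (hK : IsCompact K) :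
    MeasurableSet (regularBoundary K) := by
  set Γ := {z : E n × S n | z.1 ∈ frontier K ∧ IsOuterNormal K z.1 z.2} with hΓ
  have hc : IsCompact Γ := isCompact_normals hK
  -- pairs of normals at the same point, at distance at least `1 / (k + 1)`
  let P : ℕ → Set ((E n × S n) × (E n × S n)) := fun k =>
    (Γ ×ˢ Γ) ∩ {z | z.1.1 = z.2.1 ∧ 1 / ((k : ℝ) + 1) ≤ dist z.1.2 z.2.2}
  have hP : ∀ k, IsCompact (P k) := fun k => by
    refine (hc.prod hc).inter_right ?_
    have h1 : IsClosed {z : (E n × S n) × (E n × S n) | z.1.1 = z.2.1} :=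
      isClosed_eq (by fun_prop) (by fun_prop)
    have h2 : IsClosed {z : (E n × S n) × (E n × S n) |
        1 / ((k : ℝ) + 1) ≤ dist z.1.2 z.2.2} :=
      isClosed_le (by fun_prop) (by fun_prop)
    exact h1.inter h2
  have hEq : regularBoundary K =
      (Prod.fst '' Γ) \ ⋃ k, (fun z : (E n × S n) × (E n × S n) => z.1.1) '' P k := by
    ext x
    constructor
    · rintro ⟨hx, v, hv, huniq⟩
      refine ⟨⟨(x, v), ⟨hx, hv⟩, rfl⟩, ?_⟩
      intro hmem
      obtain ⟨k, ⟨⟨a, u⟩, ⟨b, w⟩⟩, ⟨⟨h1, h2⟩, h3, h4⟩, h5⟩ := mem_iUnion.1 hmem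
      simp only at h1 h2 h3 h4 h5
      subst h5
      subst h3
      rw [huniq u h1.2, huniq w h2.2, dist_self] at h4
      have : (0 : ℝ) < 1 / ((k : ℝ) + 1) := by positivity
      linarith
    · rintro ⟨⟨⟨a, v⟩, ⟨ha, hv⟩, h⟩, hnot⟩
      simp only at h ha hv
      subst h
      refine ⟨ha, v, hv, fun w hw => ?_⟩
      by_contra hne
      apply hnot
      obtain ⟨k, hk⟩ := exists_nat_one_div_lt (dist_pos.2 hne)
      exact mem_iUnion.2 ⟨k, ((a, w), (a, v)), ⟨⟨⟨ha, hw⟩, ⟨ha, hv⟩⟩, rfl, hk.le⟩, rfl⟩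
  rw [hEq]
  refine (hc.image continuous_fst).measurableSet.diff (MeasurableSet.iUnion fun k => ?_)
  exact ((hP k).image (by fun_prop)).measurableSet

lemma measurable_gaussMap {n : ℕ} {K : Set (E n)} (hK : IsCompact K) :
    Measurable (gaussMap K) := by
  refine measurable_of_isClosed fun C hC => ?_
  have hc : IsCompact ({z : E n × S n | z.1 ∈ frontier K ∧ IsOuterNormal K z.1 z.2} ∩
      Prod.snd ⁻¹' C) := (isCompact_normals hK).inter_right (hC.preimage continuous_snd)
  have h : gaussMap K ⁻¹' C = Subtype.val ⁻¹' (Prod.fst ''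
      ({z : E n × S n | z.1 ∈ frontier K ∧ IsOuterNormal K z.1 z.2} ∩ Prod.snd ⁻¹' C)) := by
    ext x
    constructor
    · intro hx
      exact ⟨(x, gaussMap K x), ⟨⟨x.2.1, gaussMap_spec K x⟩, hx⟩, rfl⟩
    · rintro ⟨⟨a, v⟩, ⟨⟨_, hv⟩, hvC⟩, h⟩
      simp only at h hv
      subst h
      have := eq_gaussMap K x hv
      subst this
      exact hvC
  rw [h]
  exact measurable_subtype_coe (hc.image continuous_fst).measurableSet

/-- The defining formula of the `L_p` Gaussian dual curvature measure on Borel sets. -/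
theorem lpGaussDualCurvature_apply {n : ℕ} (p q : ℝ) (K : ConvexBody (E n)) {η : Set (S n)}
    (hη : MeasurableSet η) :
    lpGaussDualCurvature p q (K : Set (E n)) η =
      ∫⁻ x in gaussMap (K : Set (E n)) ⁻¹' η,
        ENNReal.ofReal (inner ℝ (x : E n) (gaussMap (K : Set (E n)) x : E n) ^ (1 - p) *
          gaussKernel q (x : E n)) ∂(boundaryMeasure (K : Set (E n))) := by
  have hm := measurable_gaussMap K.isCompact
  rw [lpGaussDualCurvature, Measure.map_apply hm hη, withDensity_apply _ (hm hη)]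

/-- On Borel sets of `∂'K` the measure `boundaryMeasure K` is `𝓗ⁿ⁻¹`. -/
theorem boundaryMeasure_apply {n : ℕ} (K : ConvexBody (E n))
    (s : Set (regularBoundary (K : Set (E n)))) :
    boundaryMeasure (K : Set (E n)) s = μHE[n - 1] (Subtype.val '' s) :=
  (MeasurableEmbedding.subtype_coe
    (measurableSet_regularBoundary K.isCompact)).comap_apply _ s

end GaussDual

/-!
In polar coordinates `gaussDualQuermass q L` is the integral over the sphere of
`Λ (-log (gauge L u))`, where `Λ s = ∫₀^{exp s} exp (-r² / 2) r^(q - 1) dr` is Lipschitz. Suppose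
`log h_t = log h_0 + t g + o(t)` uniformly on the sphere, where `h_0` is the support function of
`K`. The gauge of the Wulff shape of `h_t` at `u` is the maximum over `v` of `⟨u, v⟩ / h_t v`, so
wherever the maximizer `v` at `t = 0` is unique, an envelope argument gives `-log (gauge u)` the
derivative `g v`. The maximizer is the outer normal of `K` where the ray through `u` meets the
boundary, and it is unique for almost every `u` because the gauge of `K` is Lipschitz, hence
almost everywhere differentiable. By dominated convergence the derivative of the quermassintegral
is `∫ exp (-ρ² / 2) ρ^q g(ν(ρ u)) du`, with `ρ = ρ(u)` the radial function of `K`.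

This is the integral of `g` against the curvature measure with `p = 0`, because the cone measure
`ρ^n du`, carried to the boundary of `K`, is `⟨x, ν(x)⟩ dH^(n-1)(x)`: a piece of the boundary on
which the subgradients of the gauge are nearly constant is mapped by a nearly isometric shear into
a hyperplane, where the cone over it becomes a pyramid.

For `h_t = (h_K^p + t f^p)^(1/p)` the velocity is `g = f^p h_K^(-p) / p`, and the curvature measure
for `p` is the one for `0` with density `h_K^(-p)`.
-/

namespace GaussDual

section Gauge

open scoped Pointwise

variable {V : Type*} [NormedAddCommGroup V] [NormedSpace ℝ V] {K : ConvexBody V}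

lemma gauge_pos_of_ne_zero (h0 : (0 : V) ∈ interior (K : Set V)) {y : V} (hy : y ≠ 0) :
    0 < gauge K y :=
  (gauge_pos (absorbent_nhds_zero (mem_interior_iff_mem_nhds.1 h0))
    (NormedSpace.isVonNBounded_of_isBounded ℝ K.isBounded)).2 hy

lemma continuous_gauge_body (h0 : (0 : V) ∈ interior (K : Set V)) :
    Continuous (gauge (K : Set V)) :=
  continuous_gauge K.convex (mem_interior_iff_mem_nhds.1 h0)

/-- The radial projection onto the boundary of a convex body with the origin in its interior. -/
noncomputable def radialMap (K : Set V) (y : V) : V := (gauge K y)⁻¹ • y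

lemma gauge_smul_radialMap (h0 : (0 : V) ∈ interior (K : Set V)) {y : V} (hy : y ≠ 0) :
    gauge K y • radialMap K y = y :=
  smul_inv_smul₀ (gauge_pos_of_ne_zero h0 hy).ne' y

lemma gauge_radialMap (h0 : (0 : V) ∈ interior (K : Set V)) {y : V} (hy : y ≠ 0) :
    gauge K (radialMap K y) = 1 := by
  have hg := gauge_pos_of_ne_zero h0 hy
  rw [radialMap, gauge_smul_of_nonneg (inv_nonneg.2 hg.le), smul_eq_mul, inv_mul_cancel₀ hg.ne']

lemma radialMap_of_gauge_eq_one {s : Set V} {x : V} (hx : gauge s x = 1) : radialMap s x = x := by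
  rw [radialMap, hx, inv_one, one_smul]

lemma radialMap_smul (s : Set V) {r : ℝ} (hr : 0 < r) (y : V) :
    radialMap s (r • y) = radialMap s y := by
  rw [radialMap, radialMap, gauge_smul_of_nonneg hr.le, smul_eq_mul, smul_smul, mul_inv_rev,
    inv_mul_cancel_right₀ hr.ne']

lemma Ioo_smul_eq_inter_preimage_radialMap {K : ConvexBody V} (h0 : (0 : V) ∈ interior (K : Set V))
    {A : Set V} (hA : ∀ x ∈ A, gauge K x = 1) :
    Ioo (0 : ℝ) 1 • A = radialMap K ⁻¹' A ∩ {y | gauge K y < 1} := by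
  ext y
  constructor
  · rintro ⟨r, hr, x, hx, rfl⟩
    refine ⟨?_, ?_⟩
    · rwa [mem_preimage, radialMap_smul _ hr.1, radialMap_of_gauge_eq_one (hA x hx)]
    · rw [mem_ofPred_eq, gauge_smul_of_nonneg hr.1.le, hA x hx, smul_eq_mul, mul_one]
      exact hr.2
  · rintro ⟨hyA, hy⟩
    rw [mem_ofPred_eq] at hy
    have hy0 : y ≠ 0 := by
      rintro rfl
      simpa [radialMap] using hA _ hyA
    exact ⟨gauge K y, ⟨gauge_pos_of_ne_zero h0 hy0, hy⟩, _, hyA, gauge_smul_radialMap h0 hy0⟩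

lemma measurable_radialMap [MeasurableSpace V] [BorelSpace V] [SecondCountableTopology V]
    (h0 : (0 : V) ∈ interior (K : Set V)) : Measurable (radialMap (K : Set V)) :=
  (continuous_gauge_body h0).measurable.inv.smul measurable_id

end Gauge

section WulffShape

variable {n : ℕ} {h k : S n → ℝ}

lemma norm_sphere (v : S n) : ‖(v : E n)‖ = 1 := norm_eq_of_mem_sphere v

lemma inner_sphere_le (x : E n) (v : S n) : inner ℝ x (v : E n) ≤ ‖x‖ := by
  simpa [norm_sphere] using real_inner_le_norm x (v : E n)

lemma exists_eq_norm_smul_sphere {y : E n} (hy : y ≠ 0) : ∃ v : S n, y = ‖y‖ • (v : E n) :=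
  have h : ‖y‖ ≠ 0 := norm_ne_zero_iff.2 hy
  ⟨⟨‖y‖⁻¹ • y, by simp [norm_smul, h]⟩, (smul_inv_smul₀ h y).symm⟩

lemma isClosed_wulffShape (h : S n → ℝ) : IsClosed (wulffShape h) := by
  simp only [wulffShape, ofPred_forall]
  exact isClosed_iInter fun v => isClosed_le (by fun_prop) continuous_const

lemma convex_wulffShape (h : S n → ℝ) : Convex ℝ (wulffShape h) := by
  simp only [wulffShape, ofPred_forall]
  exact convex_iInter fun v =>
    convex_halfSpace_le ((innerₗ (E n)).flip (v : E n)).isLinear (h v)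

lemma isCompact_wulffShape (hc : Continuous h) : IsCompact (wulffShape h) := by
  obtain ⟨M, hM⟩ := isCompact_univ.exists_bound_of_continuousOn hc.continuousOn
  refine Metric.isCompact_of_isClosed_isBounded (isClosed_wulffShape h)
    (isBounded_iff_forall_norm_le.2 ⟨M ⊔ 0, fun y hy => ?_⟩)
  by_cases h0 : y = 0
  · simp [h0]
  obtain ⟨v, hv⟩ := exists_eq_norm_smul_sphere h0
  have hyv : inner ℝ y (v : E n) = ‖y‖ := by
    conv_lhs => rw [hv, real_inner_smul_left, real_inner_self_eq_norm_sq, norm_sphere]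
    simp
  calc ‖y‖ = inner ℝ y (v : E n) := hyv.symm
    _ ≤ h v := hy v
    _ ≤ M := (le_abs_self _).trans (hM v (mem_univ v))
    _ ≤ M ⊔ 0 := le_max_left M 0

lemma zero_mem_interior_wulffShape (hc : Continuous h) (hpos : ∀ v, 0 < h v) :
    (0 : E n) ∈ interior (wulffShape h) := by
  obtain ⟨m, hm, hmh⟩ := isCompact_univ.exists_forall_le' hc.continuousOn fun v _ => hpos v
  refine mem_interior_iff_mem_nhds.2 (mem_of_superset (Metric.closedBall_mem_nhds 0 hm) ?_)
  intro y hy v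
  exact (inner_sphere_le y v).trans ((mem_closedBall_zero_iff.1 hy).trans (hmh v (mem_univ v)))

/-- The Wulff shape of a positive continuous function, as a convex body. -/
def wulffBody (h : S n → ℝ) (hc : Continuous h) (hpos : ∀ v, 0 < h v) : ConvexBody (E n) where
  carrier := wulffShape h
  convex' := convex_wulffShape h
  isCompact' := isCompact_wulffShape hc
  nonempty' := ⟨0, interior_subset (zero_mem_interior_wulffShape hc hpos)⟩

lemma gauge_wulffShape_pos (hc : Continuous h) (hpos : ∀ v, 0 < h v) {y : E n} (hy : y ≠ 0) :
    0 < gauge (wulffShape h) y :=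
  gauge_pos_of_ne_zero (K := wulffBody h hc hpos) (zero_mem_interior_wulffShape hc hpos) hy

lemma gauge_wulffShape_le_iff (hc : Continuous h) (hpos : ∀ v, 0 < h v) {s : ℝ} (hs : 0 < s)
    (y : E n) : gauge (wulffShape h) y ≤ s ↔ ∀ v : S n, inner ℝ y (v : E n) ≤ s * h v := by
  calc gauge (wulffShape h) y ≤ s ↔ gauge (wulffShape h) (s⁻¹ • y) ≤ 1 := by
        rw [gauge_smul_of_nonneg (inv_nonneg.2 hs.le), smul_eq_mul, inv_mul_le_iff₀ hs, mul_one]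
    _ ↔ s⁻¹ • y ∈ wulffShape h := by
        rw [gauge_le_one_iff_mem_closure (convex_wulffShape h)
          (mem_interior_iff_mem_nhds.1 (zero_mem_interior_wulffShape hc hpos)),
          (isClosed_wulffShape h).closure_eq]
    _ ↔ ∀ v : S n, inner ℝ y (v : E n) ≤ s * h v := by
        simp only [wulffShape, mem_ofPred_eq, real_inner_smul_left, inv_mul_le_iff₀ hs]

lemma inner_le_gauge_wulffShape_mul (hc : Continuous h) (hpos : ∀ v, 0 < h v) (y : E n) (v : S n) :
    inner ℝ y (v : E n) ≤ gauge (wulffShape h) y * h v := by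
  by_cases hy : y = 0
  · simp [hy]
  · exact (gauge_wulffShape_le_iff hc hpos (gauge_wulffShape_pos hc hpos hy) y).1 le_rfl v

/-- The ray through `y` leaves the Wulff shape `[h]` at a point of the hyperplane
`⟨x, v⟩ = h(v)`. -/
def IsContact (h : S n → ℝ) (y : E n) (v : S n) : Prop :=
  inner ℝ y (v : E n) = gauge (wulffShape h) y * h v

lemma exists_isContact (hc : Continuous h) (hpos : ∀ v, 0 < h v) {y : E n} (hy : y ≠ 0) :
    ∃ v, IsContact h y v := by
  obtain ⟨u, hu⟩ := exists_eq_norm_smul_sphere hy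
  have hratio : Continuous fun v : S n => inner ℝ y (v : E n) / h v :=
    Continuous.div (by fun_prop) hc fun v => (hpos v).ne'
  obtain ⟨v, -, hv⟩ := isCompact_univ.exists_isMaxOn ⟨u, mem_univ u⟩ hratio.continuousOn
  have hmax : ∀ w : S n, inner ℝ y (w : E n) / h w ≤ inner ℝ y (v : E n) / h v :=
    fun w => hv (mem_univ w)
  have hs : 0 < inner ℝ y (v : E n) / h v := by
    refine lt_of_lt_of_le (div_pos ?_ (hpos u)) (hmax u)
    rw [hu, real_inner_smul_left, real_inner_self_eq_norm_sq, norm_sphere]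
    simpa using hy
  refine ⟨v, (inner_le_gauge_wulffShape_mul hc hpos y v).antisymm ?_⟩
  rw [← le_div_iff₀ (hpos v), gauge_wulffShape_le_iff hc hpos hs]
  exact fun w => (div_le_iff₀ (hpos w)).1 (hmax w)

lemma IsContact.log_gauge_sub_le {y : E n} {v : S n} (hv : IsContact h y v)
    (hc : Continuous h) (hpos : ∀ v, 0 < h v) (kc : Continuous k) (kpos : ∀ v, 0 < k v)
    (hy : y ≠ 0) :
    Real.log (gauge (wulffShape h) y) - Real.log (gauge (wulffShape k) y) ≤
      Real.log (k v) - Real.log (h v) := by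
  have hg := gauge_wulffShape_pos hc hpos hy
  have kg := gauge_wulffShape_pos kc kpos hy
  have hle : gauge (wulffShape h) y * h v ≤ gauge (wulffShape k) y * k v :=
    hv.symm.trans_le (inner_le_gauge_wulffShape_mul kc kpos y v)
  have hlog := Real.log_le_log (mul_pos hg (hpos v)) hle
  rw [Real.log_mul hg.ne' (hpos v).ne', Real.log_mul kg.ne' (kpos v).ne'] at hlog
  linarith

end WulffShape

section SupportFunction

variable {n : ℕ} {K : ConvexBody (E n)}

lemma continuous_supportFun (K : ConvexBody (E n)) :
    Continuous fun v : S n => supportFun (K : Set (E n)) v :=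
  K.isCompact.continuous_sSup (f := fun (v : S n) (y : E n) => inner ℝ (v : E n) y) (by fun_prop)

lemma supportFun_pos (h0 : (0 : E n) ∈ interior (K : Set (E n))) (v : S n) :
    0 < supportFun (K : Set (E n)) v := by
  obtain ⟨m, hm, hball⟩ :=
    Metric.nhds_basis_closedBall.mem_iff.1 (mem_interior_iff_mem_nhds.1 h0)
  have hmem : m • (v : E n) ∈ (K : Set (E n)) :=
    hball (by simp [norm_smul, abs_of_pos hm])
  calc 0 < m := hm
    _ = inner ℝ (v : E n) (m • (v : E n)) := by
      simp [inner_smul_right]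
    _ ≤ supportFun (K : Set (E n)) v := le_supportFun K.isCompact _ hmem

lemma wulffShape_supportFun (K : ConvexBody (E n)) :
    wulffShape (fun v : S n => supportFun (K : Set (E n)) v) = K := by
  refine Subset.antisymm (fun x hx => ?_) fun x hx v => ?_
  · by_contra hxK
    obtain ⟨φ, u, hφK, hφx⟩ := geometric_hahn_banach_closed_point K.convex K.isClosed hxK
    obtain ⟨y, rfl⟩ := (InnerProductSpace.toDual ℝ (E n)).surjective φ
    simp only [InnerProductSpace.toDual_apply_apply] at hφK hφx
    obtain ⟨z, hz⟩ := K.nonempty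
    have hy : y ≠ 0 := by
      rintro rfl
      have := (hφK z hz).trans hφx
      simp at this
    obtain ⟨v, hv⟩ := exists_eq_norm_smul_sphere hy
    have hle : ‖y‖ * supportFun (K : Set (E n)) v ≤ u := by
      rw [← le_div_iff₀' (norm_pos_iff.2 hy)]
      refine csSup_le (K.nonempty.image _) ?_
      rintro _ ⟨z, hz, rfl⟩
      rw [le_div_iff₀' (norm_pos_iff.2 hy), ← real_inner_smul_left, ← hv]
      exact (hφK z hz).le
    refine hφx.not_ge ?_
    calc inner ℝ y x = ‖y‖ * inner ℝ x (v : E n) := by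
          conv_lhs => rw [hv, real_inner_smul_left, real_inner_comm]
      _ ≤ ‖y‖ * supportFun (K : Set (E n)) v := by gcongr; exact hx v
      _ ≤ u := hle
  · rw [real_inner_comm]
    exact le_supportFun K.isCompact _ hx

lemma inner_le_gauge_mul_supportFun (h0 : (0 : E n) ∈ interior (K : Set (E n))) (y : E n)
    (v : S n) : inner ℝ y (v : E n) ≤ gauge K y * supportFun (K : Set (E n)) v := by
  simpa only [wulffShape_supportFun] using
    inner_le_gauge_wulffShape_mul (continuous_supportFun K) (supportFun_pos h0) y v

lemma isContact_supportFun_iff (h0 : (0 : E n) ∈ interior (K : Set (E n))) {y : E n} (hy : y ≠ 0)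
    {v : S n} : IsContact (fun v : S n => supportFun (K : Set (E n)) v) y v ↔
      IsOuterNormal K (radialMap K y) v := by
  rw [IsContact, wulffShape_supportFun, IsOuterNormal, radialMap, real_inner_smul_left,
    inv_mul_eq_iff_eq_mul₀ (gauge_pos_of_ne_zero h0 hy).ne']

end SupportFunction

section Subgradient

variable {V : Type*} [NormedAddCommGroup V] [InnerProductSpace ℝ V] {s : Set V} {x w : V}

/-- `w` is a subgradient of the gauge of `s` at `x`. Since the gauge is positively homogeneous, the
usual inequality `gauge s x + ⟪z - x, w⟫ ≤ gauge s z` splits into the two conditions here. -/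
structure IsGaugeSubgradient (s : Set V) (x w : V) : Prop where
  inner_le : ∀ z, inner ℝ z w ≤ gauge s z
  inner_eq : inner ℝ x w = gauge s x

lemma IsGaugeSubgradient.ne_zero (h : IsGaugeSubgradient s x w) (hx : gauge s x = 1) : w ≠ 0 := by
  rintro rfl
  simpa [hx] using h.inner_eq

lemma IsGaugeSubgradient.smul (h : IsGaugeSubgradient s x w) {r : ℝ} (hr : 0 ≤ r) :
    IsGaugeSubgradient s (r • x) w :=
  ⟨h.inner_le, by rw [real_inner_smul_left, h.inner_eq, gauge_smul_of_nonneg hr, smul_eq_mul]⟩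

lemma IsGaugeSubgradient.innerSL_eq_fderiv (h : IsGaugeSubgradient s x w)
    (hd : DifferentiableAt ℝ (gauge s) x) : innerSL ℝ w = fderiv ℝ (gauge s) x := by
  have hmin : IsLocalMin (fun z => gauge s z - innerSL ℝ w z) x := Eventually.of_forall fun z => by
    simpa [real_inner_comm, h.inner_eq] using h.inner_le z
  exact (sub_eq_zero.1 (hmin.hasFDerivAt_eq_zero
    (hd.hasFDerivAt.sub (innerSL ℝ w).hasFDerivAt))).symm

lemma IsGaugeSubgradient.eq {w' : V} (h : IsGaugeSubgradient s x w)
    (h' : IsGaugeSubgradient s x w') (hd : DifferentiableAt ℝ (gauge s) x) : w = w' :=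
  (innerSL_inj (𝕜 := ℝ)).1 ((h.innerSL_eq_fderiv hd).trans (h'.innerSL_eq_fderiv hd).symm)

lemma differentiableAt_gauge_of_smul {r : ℝ} (hr : 0 < r)
    (hd : DifferentiableAt ℝ (gauge s) (r • x)) : DifferentiableAt ℝ (gauge s) x := by
  have hscale : gauge s = fun z => r⁻¹ * gauge s (r • z) := by
    ext z
    rw [gauge_smul_of_nonneg hr.le, smul_eq_mul, inv_mul_cancel_left₀ hr.ne']
  rw [hscale]
  exact (DifferentiableAt.comp x (g := gauge s) (f := (r • ·)) hd (by fun_prop)).const_mul _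

lemma ae_toSphere_differentiableAt_gauge [FiniteDimensional ℝ V] [MeasurableSpace V]
    [BorelSpace V] (μ : Measure V) [μ.IsAddHaarMeasure] {K : ConvexBody V}
    (h0 : (0 : V) ∈ interior (K : Set V)) :
    ∀ᵐ u : Metric.sphere (0 : V) 1 ∂μ.toSphere, DifferentiableAt ℝ (gauge (K : Set V)) (u : V) := by
  obtain ⟨C, hC⟩ := K.convex.lipschitz_gauge (mem_interior_iff_mem_nhds.1 h0)
  have hmeas : MeasurableSet {u : Metric.sphere (0 : V) 1 |
      ¬ DifferentiableAt ℝ (gauge (K : Set V)) (u : V)} :=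
    (measurable_subtype_coe (measurableSet_of_differentiableAt ℝ _)).compl
  rw [ae_iff, Measure.toSphere_apply' _ hmeas, mul_eq_zero]
  refine Or.inr (measure_mono_null ?_ (ae_iff.1 hC.ae_differentiableAt))
  rintro _ ⟨r, hr, _, ⟨u, hu, rfl⟩, rfl⟩ hd
  exact hu (differentiableAt_gauge_of_smul hr.1 hd)

end Subgradient

section OuterNormal

variable {n : ℕ}

instance [NeZero n] : Nonempty (S n) := NormedSpace.sphere_nonempty_rclike ℝ zero_le_one

/-- The Gauss map of `K`, extended from the regular boundary to the whole space by an arbitrary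
value. -/
noncomputable def outerNormal [NeZero n] (K : Set (E n)) : E n → S n :=
  Function.extend Subtype.val (gaussMap K) fun _ => Classical.arbitrary _

lemma outerNormal_coe [NeZero n] {K : Set (E n)} (x : regularBoundary K) :
    outerNormal K x = gaussMap K x :=
  Subtype.val_injective.extend_apply _ _ x

lemma isOuterNormal_outerNormal [NeZero n] {K : Set (E n)} {x : E n}
    (hx : x ∈ regularBoundary K) : IsOuterNormal K x (outerNormal K x) :=
  (outerNormal_coe ⟨x, hx⟩).symm ▸ gaussMap_spec K ⟨x, hx⟩

lemma IsOuterNormal.eq_outerNormal [NeZero n] {K : Set (E n)} {x : E n} {v : S n}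
    (hv : IsOuterNormal K x v) (hx : x ∈ regularBoundary K) : v = outerNormal K x :=
  (eq_gaussMap K ⟨x, hx⟩ hv).trans (outerNormal_coe ⟨x, hx⟩).symm

variable {K : ConvexBody (E n)}

lemma measurable_outerNormal [NeZero n] (K : ConvexBody (E n)) :
    Measurable (outerNormal (K : Set (E n))) :=
  (MeasurableEmbedding.subtype_coe (measurableSet_regularBoundary K.isCompact)).measurable_extend
    (measurable_gaussMap K.isCompact) measurable_const

lemma gauge_eq_one_of_mem_regularBoundary (h0 : (0 : E n) ∈ interior (K : Set (E n))) {x : E n}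
    (hx : x ∈ regularBoundary (K : Set (E n))) : gauge K x = 1 :=
  (gauge_eq_one_iff_mem_frontier K.convex (mem_interior_iff_mem_nhds.1 h0)).2 hx.1

lemma IsOuterNormal.isGaugeSubgradient {x : E n} {v : S n} (hv : IsOuterNormal (K : Set (E n)) x v)
    (h0 : (0 : E n) ∈ interior (K : Set (E n))) (hx : gauge K x = 1) :
    IsGaugeSubgradient (K : Set (E n)) x ((supportFun (K : Set (E n)) v)⁻¹ • (v : E n)) where
  inner_le z := by
    rw [inner_smul_right, inv_mul_le_iff₀ (supportFun_pos h0 v), mul_comm]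
    exact inner_le_gauge_mul_supportFun h0 z v
  inner_eq := by
    rw [inner_smul_right, show inner ℝ x (v : E n) = _ from hv,
      inv_mul_cancel₀ (supportFun_pos h0 v).ne', hx]

lemma norm_inv_supportFun_smul (h0 : (0 : E n) ∈ interior (K : Set (E n))) (v : S n) :
    ‖(supportFun (K : Set (E n)) v)⁻¹ • (v : E n)‖ = (supportFun (K : Set (E n)) v)⁻¹ := by
  rw [norm_smul, norm_sphere, mul_one, norm_inv, Real.norm_of_nonneg (supportFun_pos h0 v).le]

lemma radialMap_mem_regularBoundary [NeZero n] (h0 : (0 : E n) ∈ interior (K : Set (E n)))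
    {y : E n} (hy : y ≠ 0) (hd : DifferentiableAt ℝ (gauge (K : Set (E n))) y) :
    radialMap K y ∈ regularBoundary (K : Set (E n)) := by
  have hgauge := gauge_radialMap h0 hy
  have hd' : DifferentiableAt ℝ (gauge (K : Set (E n))) (radialMap K y) :=
    differentiableAt_gauge_of_smul (gauge_pos_of_ne_zero h0 hy)
      (by rwa [gauge_smul_radialMap h0 hy])
  obtain ⟨v, hv⟩ := exists_isContact (continuous_supportFun K) (supportFun_pos h0) hy
  rw [isContact_supportFun_iff h0 hy] at hv
  refine ⟨(gauge_eq_one_iff_mem_frontier K.convex (mem_interior_iff_mem_nhds.1 h0)).1 hgauge,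
    v, hv, fun u hu => Subtype.ext ?_⟩
  have hgrad := (hu.isGaugeSubgradient h0 hgauge).eq (hv.isGaugeSubgradient h0 hgauge) hd'
  have hnorm := congrArg norm hgrad
  rw [norm_inv_supportFun_smul h0, norm_inv_supportFun_smul h0] at hnorm
  rw [hnorm] at hgrad
  exact smul_right_injective _ (inv_pos.2 (supportFun_pos h0 v)).ne' hgrad

lemma ae_radialMap_mem_regularBoundary [NeZero n] (h0 : (0 : E n) ∈ interior (K : Set (E n))) :
    ∀ᵐ u : S n ∂(volume : Measure (E n)).toSphere,
      radialMap K (u : E n) ∈ regularBoundary (K : Set (E n)) := by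
  filter_upwards [ae_toSphere_differentiableAt_gauge volume h0] with u hu
  exact radialMap_mem_regularBoundary h0 (ne_zero_of_mem_unit_sphere u) hu

end OuterNormal

section PolarCoordinates

open scoped ENNReal Pointwise
open Module (finrank)

variable {V : Type*} [NormedAddCommGroup V] [NormedSpace ℝ V] [FiniteDimensional ℝ V]
  [MeasurableSpace V] [BorelSpace V] [Nontrivial V] (μ : Measure V) [μ.IsAddHaarMeasure]

lemma lintegral_eq_lintegral_toSphere {F : V → ℝ≥0∞} (hF : Measurable F) :
    ∫⁻ y, F y ∂μ = ∫⁻ u : Metric.sphere (0 : V) 1, (∫⁻ r in Ioi (0 : ℝ),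
      ENNReal.ofReal (r ^ (finrank ℝ V - 1)) * F (r • (u : V))) ∂μ.toSphere := by
  have hpolar : Measurable fun z : Metric.sphere (0 : V) 1 × Ioi (0 : ℝ) =>
      F (z.2.1 • (z.1 : V)) := hF.comp (by fun_prop)
  calc ∫⁻ y, F y ∂μ = ∫⁻ y : ({0}ᶜ : Set V), F y ∂(μ.comap Subtype.val) := by
        rw [lintegral_subtype_comap (measurableSet_singleton _).compl, restrict_compl_singleton]
    _ = ∫⁻ z : Metric.sphere (0 : V) 1 × Ioi (0 : ℝ), F (z.2.1 • (z.1 : V))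
          ∂(μ.toSphere.prod (Measure.volumeIoiPow (finrank ℝ V - 1))) := by
        rw [← μ.measurePreserving_homeomorphUnitSphereProd.lintegral_comp hpolar]
        refine lintegral_congr fun y => ?_
        rw [← homeomorphUnitSphereProd_symm_apply_coe, Homeomorph.symm_apply_apply]
    _ = _ := by
        rw [lintegral_prod _ hpolar.aemeasurable]
        refine lintegral_congr fun u => ?_
        have hray : Measurable fun r : Ioi (0 : ℝ) => F (r.1 • (u : V)) := hF.comp (by fun_prop)
        rw [Measure.volumeIoiPow, lintegral_withDensity_eq_lintegral_mul _ (by fun_prop) hray,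
          ← lintegral_subtype_comap measurableSet_Ioi]
        rfl

lemma setLIntegral_gauge_lt_one {K : ConvexBody V} (h0 : (0 : V) ∈ interior (K : Set V))
    {F : V → ℝ≥0∞} (hF : Measurable F) :
    ∫⁻ y in {y | gauge K y < 1}, F y ∂μ = ∫⁻ u : Metric.sphere (0 : V) 1,
      (∫⁻ r in Ioo 0 (gauge K (u : V))⁻¹, ENNReal.ofReal (r ^ (finrank ℝ V - 1)) * F (r • (u : V)))
        ∂μ.toSphere := by
  have hball : MeasurableSet {y : V | gauge K y < 1} :=
    measurableSet_lt (continuous_gauge_body h0).measurable measurable_const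
  rw [← lintegral_indicator hball, lintegral_eq_lintegral_toSphere μ (hF.indicator hball)]
  refine lintegral_congr fun u => ?_
  have hg := gauge_pos_of_ne_zero h0 (ne_zero_of_mem_unit_sphere u)
  rw [← Ioi_inter_Iio, inter_comm, ← setLIntegral_indicator measurableSet_Iio]
  refine setLIntegral_congr_fun measurableSet_Ioi fun r hr => ?_
  have hmem : r • (u : V) ∈ {y | gauge K y < 1} ↔ r ∈ Iio (gauge K (u : V))⁻¹ := by
    rw [mem_ofPred_eq, gauge_smul_of_nonneg hr.le, smul_eq_mul, mem_Iio, lt_inv_comm₀ hr hg,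
      ← one_div, lt_div_iff₀' hr]
  by_cases hr' : r ∈ Iio (gauge K (u : V))⁻¹
  · rw [indicator_of_mem hr', indicator_of_mem (hmem.2 hr')]
  · rw [indicator_of_notMem hr', indicator_of_notMem (mt hmem.1 hr'), mul_zero]

lemma setLIntegral_Ioo_pow (k : ℕ) {ρ : ℝ} (hρ : 0 ≤ ρ) :
    ∫⁻ r in Ioo 0 ρ, ENNReal.ofReal (r ^ k) = ENNReal.ofReal (ρ ^ (k + 1) / (k + 1)) := by
  rw [← ofReal_integral_eq_lintegral_ofReal
      ((intervalIntegral.intervalIntegrable_pow k).1.mono_set Ioo_subset_Ioc_self)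
      (ae_restrict_of_forall_mem measurableSet_Ioo fun r hr => pow_nonneg hr.1.le k),
    ← integral_Ioc_eq_integral_Ioo, ← intervalIntegral.integral_of_le hρ, integral_pow]
  simp

/-- The cone measure of a convex body with the origin in its interior: the image on the boundary of
the measure `ρ_K(u) ^ dim V du` on directions, where `ρ_K = 1 / gauge K` is the radial function. -/
noncomputable def coneMeasure (K : ConvexBody V) : Measure V :=
  (μ.toSphere.withDensity fun u : Metric.sphere (0 : V) 1 =>
    ENNReal.ofReal ((gauge K (u : V))⁻¹ ^ finrank ℝ V)).map
      fun u : Metric.sphere (0 : V) 1 => radialMap K (u : V)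

lemma coneMeasure_apply {K : ConvexBody V} (h0 : (0 : V) ∈ interior (K : Set V)) {A : Set V}
    (hA : MeasurableSet A) (hA1 : ∀ x ∈ A, gauge K x = 1) :
    coneMeasure μ K A = finrank ℝ V * μ (Ioo (0 : ℝ) 1 • A) := by
  have hdim : (0 : ℝ) < finrank ℝ V := by exact_mod_cast Module.finrank_pos
  have hρ : Measurable fun u : Metric.sphere (0 : V) 1 => (gauge K (u : V))⁻¹ :=
    ((continuous_gauge_body h0).comp continuous_subtype_val).measurable.inv
  have hmap := measurable_radialMap h0
  have hmap' : Measurable fun u : Metric.sphere (0 : V) 1 => radialMap K (u : V) :=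
    hmap.comp measurable_subtype_coe
  have hvol : μ (Ioo (0 : ℝ) 1 • A) =
      ∫⁻ u in (fun u : Metric.sphere (0 : V) 1 => radialMap K (u : V)) ⁻¹' A,
        ENNReal.ofReal ((gauge K (u : V))⁻¹ ^ finrank ℝ V / finrank ℝ V) ∂μ.toSphere := by
    rw [Ioo_smul_eq_inter_preimage_radialMap h0 hA1, ← Measure.restrict_apply (hmap hA),
      ← lintegral_indicator_one (hmap hA),
      setLIntegral_gauge_lt_one μ h0 (measurable_one.indicator (hmap hA)),
      ← lintegral_indicator (hmap' hA)]
    refine lintegral_congr fun u => ?_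
    have hray : ∀ r ∈ Ioo 0 (gauge K (u : V))⁻¹, ENNReal.ofReal (r ^ (finrank ℝ V - 1)) *
        A.indicator 1 (radialMap K (r • (u : V))) =
          ENNReal.ofReal (r ^ (finrank ℝ V - 1)) * A.indicator 1 (radialMap K (u : V)) :=
      fun r hr => by rw [radialMap_smul _ hr.1]
    refine (setLIntegral_congr_fun measurableSet_Ioo hray).trans ?_
    rw [lintegral_mul_const _ (by fun_prop),
      setLIntegral_Ioo_pow _ (inv_nonneg.2 (gauge_nonneg _)), ← Nat.cast_add_one,
      Nat.sub_add_cancel Module.finrank_pos]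
    by_cases hu : radialMap K (u : V) ∈ A <;> simp [hu]
  rw [hvol, coneMeasure, Measure.map_apply hmap' hA, withDensity_apply _ (hmap' hA),
    ← lintegral_const_mul _ (by fun_prop)]
  refine lintegral_congr fun u => ?_
  rw [← ENNReal.ofReal_natCast, ← ENNReal.ofReal_mul hdim.le, mul_div_cancel₀ _ hdim.ne']

end PolarCoordinates

section EqUpTo

open scoped NNReal ENNReal

/-- `a` and `b` agree up to the factor `c`. Two measures are shown to be equal by comparing them in
this sense on small pieces, for every `c > 1`. -/
def EqUpTo (c : ℝ≥0) (a b : ℝ≥0∞) : Prop := a ≤ c * b ∧ b ≤ c * a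

variable {c c' : ℝ≥0} {a b d : ℝ≥0∞}

lemma EqUpTo.symm (h : EqUpTo c a b) : EqUpTo c b a := And.symm h

lemma EqUpTo.trans (h : EqUpTo c a b) (h' : EqUpTo c' b d) : EqUpTo (c * c') a d := by
  constructor
  · calc a ≤ c * b := h.1
      _ ≤ c * (c' * d) := by gcongr; exact h'.1
      _ = (c * c' : ℝ≥0) * d := by rw [ENNReal.coe_mul, mul_assoc]
  · calc d ≤ c' * b := h'.2
      _ ≤ c' * (c * a) := by gcongr; exact h.2
      _ = (c * c' : ℝ≥0) * a := by rw [ENNReal.coe_mul, mul_left_comm, mul_assoc]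

lemma EqUpTo.mul_left (h : EqUpTo c a b) (e : ℝ≥0∞) : EqUpTo c (e * a) (e * b) := by
  refine ⟨?_, ?_⟩ <;> rw [mul_left_comm] <;> gcongr
  exacts [h.1, h.2]

lemma eq_of_forall_eqUpTo_pow (k : ℕ) (h : ∀ c : ℝ≥0, 1 < c → EqUpTo (c ^ k) a b) : a = b := by
  have le_of_forall {x y : ℝ≥0∞} (hxy : ∀ c : ℝ≥0, 1 < c → x ≤ (c ^ k : ℝ≥0) * y) : x ≤ y := by
    rcases eq_or_ne y ∞ with rfl | hy
    · exact le_top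
    have hlim : Tendsto (fun c : ℝ≥0 => ((c ^ k : ℝ≥0) : ℝ≥0∞) * y) (𝓝[>] 1) (𝓝 y) := by
      have hpow : Tendsto (fun c : ℝ≥0 => ((c ^ k : ℝ≥0) : ℝ≥0∞)) (𝓝 1) (𝓝 1) :=
        (ENNReal.continuous_coe.comp (continuous_pow k)).tendsto' 1 1 (by simp)
      simpa using ENNReal.Tendsto.mul_const (hpow.mono_left nhdsWithin_le_nhds) (Or.inr hy)
    exact ge_of_tendsto hlim (eventually_mem_nhdsWithin.mono hxy)
  exact le_antisymm (le_of_forall fun c hc => (h c hc).1) (le_of_forall fun c hc => (h c hc).2)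

lemma EqUpTo.setLIntegral {α : Type*} [MeasurableSpace α] {μ : Measure α} {f : α → ℝ≥0∞}
    {A : Set α} (hf : Measurable f) (h : ∀ x ∈ A, EqUpTo c (f x) a) :
    EqUpTo c (∫⁻ x in A, f x ∂μ) (a * μ A) := by
  constructor
  · rw [← mul_assoc, ← setLIntegral_const]
    exact setLIntegral_mono measurable_const fun x hx => (h x hx).1
  · rw [← lintegral_const_mul _ hf, ← setLIntegral_const]
    exact setLIntegral_mono (hf.const_mul _) fun x hx => (h x hx).2

lemma eqUpTo_measure_of_cover {α : Type*} [MeasurableSpace α] {μ ν : Measure α} {A : Set α}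
    {D : ℕ → Set α} (hA : MeasurableSet A) (hD : ∀ i, MeasurableSet (D i)) (hcover : A ⊆ ⋃ i, D i)
    (h : ∀ i, ∀ B ⊆ A ∩ D i, MeasurableSet B → EqUpTo c (μ B) (ν B)) : EqUpTo c (μ A) (ν A) := by
  have hm : ∀ i, MeasurableSet (A ∩ disjointed D i) := fun i =>
    hA.inter (MeasurableSet.disjointed hD i)
  have hsum (ρ : Measure α) : ρ A = ∑' i, ρ (A ∩ disjointed D i) := by
    rw [← measure_iUnion (fun i j hij => (disjoint_disjointed D hij).mono inter_subset_right
      inter_subset_right) hm, ← inter_iUnion, iUnion_disjointed, inter_eq_left.2 hcover]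
  have hpiece (i : ℕ) : EqUpTo c (μ (A ∩ disjointed D i)) (ν (A ∩ disjointed D i)) :=
    h i _ (inter_subset_inter_right _ (disjointed_subset D i)) (hm i)
  rw [hsum μ, hsum ν]
  constructor <;> rw [← ENNReal.tsum_mul_left]
  exacts [ENNReal.tsum_le_tsum fun i => (hpiece i).1, ENNReal.tsum_le_tsum fun i => (hpiece i).2]

lemma norm_le_and_norm_le_of_norm_sub_le {V : Type*} [SeminormedAddCommGroup V] {c : ℝ}
    (hc : 1 ≤ c) {x y : V} (h : ‖x - y‖ ≤ (1 - c⁻¹) * ‖y‖) : ‖x‖ ≤ c * ‖y‖ ∧ ‖y‖ ≤ c * ‖x‖ := by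
  have hc0 : 0 < c := zero_lt_one.trans_le hc
  have hcc : 2 - c⁻¹ ≤ c := by
    have hsq : c⁻¹ * (c - 1) ^ 2 = c - (2 - c⁻¹) := by field_simp; ring
    exact sub_nonneg.1 (hsq ▸ by positivity)
  constructor
  · have := norm_le_norm_add_norm_sub' x y
    nlinarith [norm_nonneg y]
  · have := norm_le_norm_add_norm_sub x y
    rw [← inv_mul_le_iff₀ hc0]
    linarith

lemma eqUpTo_ofReal_inv_norm {V : Type*} [NormedAddCommGroup V] (hc : 1 ≤ c) {x y : V}
    (h : ‖x - y‖ ≤ (1 - (c : ℝ)⁻¹) * ‖y‖) :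
    EqUpTo c (ENNReal.ofReal ‖x‖⁻¹) (ENNReal.ofReal ‖y‖⁻¹) := by
  obtain ⟨hxy, hyx⟩ := norm_le_and_norm_le_of_norm_sub_le (by exact_mod_cast hc) h
  have inv_le {s t : ℝ} (hs : 0 ≤ s) (hst : s ≤ c * t) (hts : t ≤ c * s) :
      ENNReal.ofReal t⁻¹ ≤ c * ENNReal.ofReal s⁻¹ := by
    rw [← ENNReal.ofReal_coe_nnreal, ← ENNReal.ofReal_mul c.coe_nonneg]
    refine ENNReal.ofReal_le_ofReal ?_
    rcases hs.eq_or_lt with rfl | hs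
    · simp only [mul_zero] at hts
      simpa using hts
    have ht : 0 < t := pos_of_mul_pos_right (hs.trans_le hst) c.coe_nonneg
    rwa [← div_eq_mul_inv, le_div_iff₀ hs, inv_mul_le_iff₀ ht, mul_comm]
  exact ⟨inv_le (norm_nonneg y) hyx hxy, inv_le (norm_nonneg x) hxy hyx⟩

end EqUpTo

section BiLipschitz

open scoped NNReal ENNReal

variable {X Y : Type*} [MetricSpace X] [MeasurableSpace X] [BorelSpace X] [MetricSpace Y]
  [MeasurableSpace Y] [BorelSpace Y] {c : ℝ≥0} {s : Set X}

lemma euclideanHausdorffMeasure_image_le {f : X → Y} (hf : LipschitzOnWith c f s) (d : ℕ) :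
    μHE[d] (f '' s) ≤ (c : ℝ≥0∞) ^ d * μHE[d] s := by
  simp only [Measure.euclideanHausdorffMeasure_def, Measure.smul_apply, ENNReal.smul_def,
    smul_eq_mul]
  rw [mul_left_comm]
  gcongr
  simpa using hf.hausdorffMeasure_image_le (d := d) (by positivity)

lemma eqUpTo_euclideanHausdorffMeasure_image {f : X → Y} (hf : LipschitzOnWith c f s)
    (hf' : ∀ x ∈ s, ∀ y ∈ s, dist x y ≤ c * dist (f x) (f y)) (d : ℕ) :
    EqUpTo (c ^ d) (μHE[d] (f '' s)) (μHE[d] s) := by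
  rcases s.eq_empty_or_nonempty with rfl | ⟨x₀, -⟩
  · simp [EqUpTo]
  have : Nonempty X := ⟨x₀⟩
  have hinj : InjOn f s := fun x hx y hy h => dist_le_zero.1 (by simpa [h] using hf' x hx y hy)
  have hinv : LipschitzOnWith c (Function.invFunOn f s) (f '' s) := by
    refine LipschitzOnWith.of_dist_le_mul ?_
    rintro _ ⟨x, hx, rfl⟩ _ ⟨y, hy, rfl⟩
    rw [hinj.leftInvOn_invFunOn hx, hinj.leftInvOn_invFunOn hy]
    exact hf' x hx y hy
  have hle := euclideanHausdorffMeasure_image_le hinv d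
  rw [hinj.leftInvOn_invFunOn.image_image] at hle
  rw [EqUpTo, ENNReal.coe_pow]
  exact ⟨euclideanHausdorffMeasure_image_le hf d, hle⟩

end BiLipschitz

section Pyramid

open scoped Pointwise NNReal ENNReal
open Module (finrank)

variable {V : Type*} [NormedAddCommGroup V] [InnerProductSpace ℝ V] {w : V}

/-- The foot of the perpendicular from the origin to the hyperplane `⟪·, w⟫ = 1`. -/
noncomputable def perpFoot (w : V) : V := (‖w‖ ^ 2)⁻¹ • w

lemma norm_perpFoot (w : V) : ‖perpFoot w‖ = ‖w‖⁻¹ := by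
  rw [perpFoot, norm_smul, norm_inv, norm_pow, norm_norm]
  rcases eq_or_ne ‖w‖ 0 with h | h
  · simp [h]
  · field_simp

lemma inner_perpFoot (hw : w ≠ 0) : inner ℝ (perpFoot w) w = (1 : ℝ) := by
  rw [perpFoot, real_inner_smul_left, real_inner_self_eq_norm_sq,
    inv_mul_cancel₀ (pow_ne_zero 2 (norm_ne_zero_iff.2 hw))]

lemma mem_mk'_smul_perpFoot_iff (hw : w ≠ 0) {x : ℝ} {z : V} :
    z ∈ AffineSubspace.mk' (x • perpFoot w +ᵥ (0 : V)) (Submodule.span ℝ {perpFoot w})ᗮ ↔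
      inner ℝ z w = x := by
  rw [AffineSubspace.mem_mk', Submodule.mem_orthogonal_singleton_iff_inner_left, vadd_eq_add,
    add_zero, vsub_eq_sub]
  conv_lhs => rw [show inner ℝ (z - x • perpFoot w) (perpFoot w) =
    (‖w‖ ^ 2)⁻¹ * inner ℝ (z - x • perpFoot w) w from inner_smul_right _ _ _]
  rw [mul_eq_zero, or_iff_right (inv_ne_zero (pow_ne_zero 2 (norm_ne_zero_iff.2 hw))),
    inner_sub_left, real_inner_smul_left, inner_perpFoot hw, mul_one, sub_eq_zero]

lemma Ioo_smul_inter_mk' (hw : w ≠ 0) {B : Set V} (hB : ∀ z ∈ B, inner ℝ z w = (1 : ℝ)) (x : ℝ) :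
    Ioo (0 : ℝ) 1 • B ∩ (AffineSubspace.mk' (x • perpFoot w +ᵥ (0 : V))
      (Submodule.span ℝ {perpFoot w})ᗮ : Set V) = if x ∈ Ioo (0 : ℝ) 1 then x • B else ∅ := by
  have hheight {r : ℝ} {b : V} (hb : b ∈ B) : inner ℝ (r • b) w = r := by
    rw [real_inner_smul_left, hB b hb, mul_one]
  ext z
  rw [mem_inter_iff, SetLike.mem_coe, mem_mk'_smul_perpFoot_iff hw]
  split_ifs with hx
  · constructor
    · rintro ⟨⟨r, -, b, hb, rfl⟩, hz⟩
      exact ⟨b, hb, by rw [← hz, hheight hb]⟩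
    · rintro ⟨b, hb, rfl⟩
      exact ⟨⟨x, hx, b, hb, rfl⟩, hheight hb⟩
  · simp only [mem_empty_iff_false, iff_false, not_and]
    rintro ⟨r, hr, b, hb, rfl⟩ hz
    exact hx (((hheight hb).symm.trans hz) ▸ hr)

variable [FiniteDimensional ℝ V] [MeasurableSpace V] [BorelSpace V]

lemma measurableSet_Ioo_smul {B : Set V} (hB : MeasurableSet B)
    (hBw : ∀ z ∈ B, inner ℝ z w = (1 : ℝ)) : MeasurableSet (Ioo (0 : ℝ) 1 • B) := by
  have hcone : Ioo (0 : ℝ) 1 • B = {y | inner ℝ y w ∈ Ioo (0 : ℝ) 1} ∩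
      (fun y => (inner ℝ y w : ℝ)⁻¹ • y) ⁻¹' B := by
    ext y
    constructor
    · rintro ⟨r, hr, b, hb, rfl⟩
      simp only [mem_inter_iff, mem_ofPred_eq, mem_preimage, real_inner_smul_left, hBw b hb,
        mul_one, inv_smul_smul₀ hr.1.ne']
      exact ⟨hr, hb⟩
    · rintro ⟨hy, hyB⟩
      exact ⟨inner ℝ y w, hy, _, hyB, smul_inv_smul₀ hy.1.ne' y⟩
  have hinner : Measurable fun y : V => (inner ℝ y w : ℝ) := by fun_prop
  rw [hcone]
  exact (hinner measurableSet_Ioo).inter ((hinner.inv.smul measurable_id) hB)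

lemma finrank_mul_volume_Ioo_smul [Nontrivial V] (hw : w ≠ 0) {B : Set V} (hB : MeasurableSet B)
    (hBw : ∀ z ∈ B, inner ℝ z w = (1 : ℝ)) :
    finrank ℝ V * volume (Ioo (0 : ℝ) 1 • B) =
      ENNReal.ofReal ‖w‖⁻¹ * μHE[finrank ℝ V - 1] B := by
  have hfoot : perpFoot w ≠ 0 := by
    rw [← norm_ne_zero_iff, norm_perpFoot]
    exact inv_ne_zero (norm_ne_zero_iff.2 hw)
  have hslice (x : ℝ) : μHE[finrank ℝ V - 1] (Ioo (0 : ℝ) 1 • B ∩ (AffineSubspace.mk'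
      (x • perpFoot w +ᵥ (0 : V)) (Submodule.span ℝ {perpFoot w})ᗮ : Set V)) =
      (Ioo (0 : ℝ) 1).indicator
        (fun x => ENNReal.ofReal (x ^ (finrank ℝ V - 1)) * μHE[finrank ℝ V - 1] B) x := by
    rw [Ioo_smul_inter_mk' hw hBw, indicator]
    split_ifs with hx
    · rw [Measure.euclideanHausdorffMeasure_smul₀ _ hx.1.ne', ENNReal.smul_def, smul_eq_mul,
        ENNReal.ofReal_pow hx.1.le, ← Real.enorm_of_nonneg hx.1.le, ENNReal.coe_pow,
        enorm_eq_nnnorm]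
    · exact measure_empty
  have hdim : (finrank ℝ V : ℝ≥0∞) *
      ∫⁻ x in Ioo (0 : ℝ) 1, ENNReal.ofReal (x ^ (finrank ℝ V - 1)) = 1 := by
    have hpos : (0 : ℝ) < finrank ℝ V := by exact_mod_cast Module.finrank_pos
    rw [setLIntegral_Ioo_pow _ zero_le_one, one_pow, ← Nat.cast_add_one,
      Nat.sub_add_cancel Module.finrank_pos, ← ENNReal.ofReal_natCast,
      ← ENNReal.ofReal_mul hpos.le, mul_one_div_cancel hpos.ne', ENNReal.ofReal_one]
  rw [← InnerProductSpace.euclideanHausdorffMeasure_eq_volume,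
    EuclideanGeometry.euclideanHausdorffMeasure_eq_lintegral (0 : V) hfoot
      (measurableSet_Ioo_smul hB hBw),
    lintegral_congr hslice, lintegral_indicator measurableSet_Ioo,
    lintegral_mul_const _ (by fun_prop), ← ofReal_norm, norm_perpFoot, mul_left_comm,
    ← mul_assoc (finrank ℝ V : ℝ≥0∞), hdim, one_mul]

end Pyramid

lemma exists_denseSeq_dist_lt {V : Type*} [NormedAddCommGroup V]
    [TopologicalSpace.SeparableSpace V] {w : V} (hw : w ≠ 0) {ε : ℝ} (hε : 0 < ε) :
    ∃ i, dist w (TopologicalSpace.denseSeq V i) < ε * ‖TopologicalSpace.denseSeq V i‖ := by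
  have hopen : IsOpen {y | dist w y < ε * ‖y‖} := isOpen_lt (by fun_prop) (by fun_prop)
  have hne : {y | dist w y < ε * ‖y‖}.Nonempty :=
    ⟨w, by rw [mem_ofPred_eq, dist_self]; exact mul_pos hε (norm_pos_iff.2 hw)⟩
  exact (TopologicalSpace.denseRange_denseSeq V).exists_mem_open hopen hne

section Shear

open scoped Pointwise NNReal ENNReal

variable {V : Type*} [NormedAddCommGroup V] [InnerProductSpace ℝ V] {s A : Set V} {w x y : V}

/-- The shear along `w` which replaces the height `⟪y, w⟫` of a point `y` by `gauge s y`. It sends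
the boundary of `s` into the hyperplane `⟪·, w⟫ = 1`, and it is nearly isometric where the
subgradients of the gauge are close to `w`. -/
noncomputable def gaugeShear (s : Set V) (w y : V) : V :=
  y + (gauge s y - inner ℝ y w) • perpFoot w

lemma inner_gaugeShear (hw : w ≠ 0) (y : V) : inner ℝ (gaugeShear s w y) w = gauge s y := by
  rw [gaugeShear, inner_add_left, real_inner_smul_left, inner_perpFoot hw, mul_one,
    add_sub_cancel]

lemma gaugeShear_smul {r : ℝ} (hr : 0 ≤ r) (y : V) :
    gaugeShear s w (r • y) = r • gaugeShear s w y := by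
  rw [gaugeShear, gaugeShear, gauge_smul_of_nonneg hr, real_inner_smul_left, smul_eq_mul, smul_add,
    smul_smul, mul_sub]

lemma image_gaugeShear_Ioo_smul (s : Set V) (w : V) (A : Set V) :
    gaugeShear s w '' (Ioo (0 : ℝ) 1 • A) = Ioo (0 : ℝ) 1 • gaugeShear s w '' A := by
  ext z
  constructor
  · rintro ⟨_, ⟨r, hr, x, hx, rfl⟩, rfl⟩
    exact ⟨r, hr, _, mem_image_of_mem _ hx, (gaugeShear_smul hr.1.le x).symm⟩
  · rintro ⟨r, hr, _, ⟨x, hx, rfl⟩, rfl⟩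
    exact ⟨r • x, ⟨r, hr, x, hx, rfl⟩, gaugeShear_smul hr.1.le x⟩

lemma IsGaugeSubgradient.gauge_sub_gauge_sub_inner_le {u : V} (hu : IsGaugeSubgradient s x u)
    (w y : V) : gauge s x - gauge s y - inner ℝ (x - y) w ≤ ‖u - w‖ * ‖x - y‖ :=
  calc gauge s x - gauge s y - inner ℝ (x - y) w
      ≤ inner ℝ x u - inner ℝ y u - inner ℝ (x - y) w := by
        linarith [hu.inner_le y, hu.inner_eq]
    _ = inner ℝ (x - y) (u - w) := by
        rw [inner_sub_right, inner_sub_left, inner_sub_left]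
    _ ≤ ‖u - w‖ * ‖x - y‖ := (real_inner_le_norm _ _).trans_eq (mul_comm _ _)

lemma norm_gaugeShear_sub_sub_le {ε : ℝ} (hw : w ≠ 0) {u v : V} (hu : IsGaugeSubgradient s x u)
    (huw : ‖u - w‖ ≤ ε * ‖w‖) (hv : IsGaugeSubgradient s y v) (hvw : ‖v - w‖ ≤ ε * ‖w‖) :
    ‖gaugeShear s w x - gaugeShear s w y - (x - y)‖ ≤ ε * ‖x - y‖ := by
  have hxy := hu.gauge_sub_gauge_sub_inner_le w y
  have hyx := hv.gauge_sub_gauge_sub_inner_le w x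
  have habs : |gauge s x - gauge s y - inner ℝ (x - y) w| ≤ ε * ‖w‖ * ‖x - y‖ := by
    rw [norm_sub_rev y x, ← neg_sub x y, inner_neg_left] at hyx
    rw [abs_le]
    constructor <;> nlinarith [norm_nonneg (x - y)]
  calc ‖gaugeShear s w x - gaugeShear s w y - (x - y)‖
      = ‖(gauge s x - gauge s y - inner ℝ (x - y) w) • perpFoot w‖ := by
        rw [gaugeShear, gaugeShear, inner_sub_left]
        congr 1
        module
    _ ≤ ε * ‖w‖ * ‖x - y‖ * ‖w‖⁻¹ := by
        rw [norm_smul, Real.norm_eq_abs, norm_perpFoot]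
        gcongr
    _ = ε * ‖x - y‖ := by
        have := norm_ne_zero_iff.2 hw
        field_simp

variable {c : ℝ≥0}

lemma dist_gaugeShear_le_and_le (hc : 1 ≤ c) (hw : w ≠ 0)
    (hx : ∃ u, IsGaugeSubgradient s x u ∧ ‖u - w‖ ≤ (1 - (c : ℝ)⁻¹) * ‖w‖)
    (hy : ∃ u, IsGaugeSubgradient s y u ∧ ‖u - w‖ ≤ (1 - (c : ℝ)⁻¹) * ‖w‖) :
    dist (gaugeShear s w x) (gaugeShear s w y) ≤ c * dist x y ∧
      dist x y ≤ c * dist (gaugeShear s w x) (gaugeShear s w y) := by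
  obtain ⟨u, hu, huw⟩ := hx
  obtain ⟨v, hv, hvw⟩ := hy
  simp only [dist_eq_norm]
  exact norm_le_and_norm_le_of_norm_sub_le (by exact_mod_cast hc)
    (norm_gaugeShear_sub_sub_le hw hu huw hv hvw)

lemma eqUpTo_euclideanHausdorffMeasure_gaugeShear [MeasurableSpace V] [BorelSpace V] (hc : 1 ≤ c)
    (hw : w ≠ 0)
    (hA : ∀ x ∈ A, ∃ u, IsGaugeSubgradient s x u ∧ ‖u - w‖ ≤ (1 - (c : ℝ)⁻¹) * ‖w‖) (d : ℕ) :
    EqUpTo (c ^ d) (μHE[d] (gaugeShear s w '' A)) (μHE[d] A) :=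
  eqUpTo_euclideanHausdorffMeasure_image
    (LipschitzOnWith.of_dist_le_mul fun x hx y hy =>
      (dist_gaugeShear_le_and_le hc hw (hA x hx) (hA y hy)).1)
    (fun x hx y hy => (dist_gaugeShear_le_and_le hc hw (hA x hx) (hA y hy)).2) d

end Shear

section ConeMeasure

open scoped Pointwise NNReal ENNReal
open Module (finrank)

variable {V : Type*} [NormedAddCommGroup V] [InnerProductSpace ℝ V] [FiniteDimensional ℝ V]
  [MeasurableSpace V] [BorelSpace V] [Nontrivial V] {K : ConvexBody V} {A : Set V}

lemma eqUpTo_finrank_mul_volume_Ioo_smul (h0 : (0 : V) ∈ interior (K : Set V))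
    (hA : MeasurableSet A) (hA1 : ∀ x ∈ A, gauge K x = 1) {c : ℝ≥0} (hc : 1 ≤ c) {w : V}
    (hw : w ≠ 0)
    (hAw : ∀ x ∈ A, ∃ u, IsGaugeSubgradient (K : Set V) x u ∧ ‖u - w‖ ≤ (1 - (c : ℝ)⁻¹) * ‖w‖) :
    EqUpTo (c ^ finrank ℝ V * c ^ (finrank ℝ V - 1)) (finrank ℝ V * volume (Ioo (0 : ℝ) 1 • A))
      (ENNReal.ofReal ‖w‖⁻¹ * μHE[finrank ℝ V - 1] A) := by
  have hcont : Continuous (gaugeShear (K : Set V) w) := by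
    have := continuous_gauge_body h0
    unfold gaugeShear
    fun_prop
  have hinj : InjOn (gaugeShear (K : Set V) w) A := fun x hx y hy h => by
    have hxy := (dist_gaugeShear_le_and_le hc hw (hAw x hx) (hAw y hy)).2
    rw [h, dist_self, mul_zero] at hxy
    exact dist_le_zero.1 hxy
  have hflat := finrank_mul_volume_Ioo_smul hw
    (hA.image_of_continuousOn_injOn hcont.continuousOn hinj)
    (forall_mem_image.2 fun x hx => by rw [inner_gaugeShear hw, hA1 x hx])
  have hcone : ∀ y ∈ Ioo (0 : ℝ) 1 • A,
      ∃ u, IsGaugeSubgradient (K : Set V) y u ∧ ‖u - w‖ ≤ (1 - (c : ℝ)⁻¹) * ‖w‖ := by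
    rintro _ ⟨r, hr, x, hx, rfl⟩
    obtain ⟨u, hu, huw⟩ := hAw x hx
    exact ⟨u, hu.smul hr.1.le, huw⟩
  have hvol := eqUpTo_euclideanHausdorffMeasure_gaugeShear hc hw hcone (finrank ℝ V)
  rw [InnerProductSpace.euclideanHausdorffMeasure_eq_volume, image_gaugeShear_Ioo_smul] at hvol
  have harea := eqUpTo_euclideanHausdorffMeasure_gaugeShear hc hw hAw (finrank ℝ V - 1)
  exact (hvol.symm.mul_left _).trans (hflat ▸ harea.mul_left _)

/-- The cone over a small piece of the boundary is nearly a pyramid, of height `‖w x‖⁻¹`. -/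
theorem coneMeasure_eq_setLIntegral (h0 : (0 : V) ∈ interior (K : Set V)) (hA : MeasurableSet A)
    (hA1 : ∀ x ∈ A, gauge K x = 1) {w : V → V} (hwm : Measurable w)
    (hw : ∀ x ∈ A, IsGaugeSubgradient (K : Set V) x (w x)) :
    coneMeasure volume K A = ∫⁻ x in A, ENNReal.ofReal ‖w x‖⁻¹ ∂μHE[finrank ℝ V - 1] := by
  have hdens : Measurable fun x => ENNReal.ofReal ‖w x‖⁻¹ := by fun_prop
  rw [← withDensity_apply _ hA]
  refine eq_of_forall_eqUpTo_pow (finrank ℝ V + (finrank ℝ V - 1) + 1) fun c hc => ?_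
  have hε : 0 < 1 - (c : ℝ)⁻¹ := sub_pos.2 (inv_lt_one_of_one_lt₀ (by exact_mod_cast hc))
  let D (i : ℕ) : Set V := {x | dist (w x) (TopologicalSpace.denseSeq V i) <
    (1 - (c : ℝ)⁻¹) * ‖TopologicalSpace.denseSeq V i‖}
  refine eqUpTo_measure_of_cover (D := D) hA (fun i => measurableSet_lt (by fun_prop) (by fun_prop))
    (fun x hx => mem_iUnion.2 (exists_denseSeq_dist_lt ((hw x hx).ne_zero (hA1 x hx)) hε))
    fun i B hB hBm => ?_
  rcases B.eq_empty_or_nonempty with rfl | ⟨x₀, hx₀⟩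
  · simp [EqUpTo]
  have hclose (x : V) (hx : x ∈ B) : ‖w x - TopologicalSpace.denseSeq V i‖ ≤
      (1 - (c : ℝ)⁻¹) * ‖TopologicalSpace.denseSeq V i‖ := by
    rw [← dist_eq_norm]
    exact (hB hx).2.le
  have hw₀ : TopologicalSpace.denseSeq V i ≠ 0 := by
    intro h
    have hx₀D : dist (w x₀) _ < (1 - (c : ℝ)⁻¹) * _ := (hB hx₀).2
    rw [h, norm_zero, mul_zero] at hx₀D
    exact hx₀D.not_ge dist_nonneg
  rw [coneMeasure_apply volume h0 hBm fun x hx => hA1 x (hB hx).1, withDensity_apply _ hBm,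
    pow_succ, pow_add]
  exact (eqUpTo_finrank_mul_volume_Ioo_smul h0 hBm (fun x hx => hA1 x (hB hx).1) hc.le hw₀
    fun x hx => ⟨w x, hw x (hB hx).1, hclose x hx⟩).trans
    (EqUpTo.setLIntegral hdens fun x hx => eqUpTo_ofReal_inv_norm hc.le (hclose x hx)).symm

end ConeMeasure

section CurvatureMeasure

open scoped ENNReal

lemma withDensity_map {X Y : Type*} [MeasurableSpace X] [MeasurableSpace Y] (μ : Measure X)
    {T : X → Y} (hT : Measurable T) {g : Y → ℝ≥0∞} (hg : Measurable g) :
    (μ.map T).withDensity g = (μ.withDensity fun x => g (T x)).map T := by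
  ext s hs
  rw [withDensity_apply _ hs, setLIntegral_map hs hg hT, Measure.map_apply hT hs,
    withDensity_apply _ (hT hs)]

lemma isFiniteMeasure_withDensity_of_continuous {X : Type*} [TopologicalSpace X] [CompactSpace X]
    [MeasurableSpace X] [OpensMeasurableSpace X] {μ : Measure X} [IsFiniteMeasure μ] {g : X → ℝ}
    (hg : Continuous g) : IsFiniteMeasure (μ.withDensity fun x => ENNReal.ofReal (g x)) :=
  isFiniteMeasure_withDensity_ofReal
    (hg.integrable_of_hasCompactSupport (HasCompactSupport.of_compactSpace g)).2

/-- The Gaussian weight `e ^ (-r ^ 2 / 2) * r ^ s` on the half-line. In the radial variable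
`gaussKernel q` is the weight of exponent `q - n`, and polar coordinates raise the exponent. -/
noncomputable def gaussWeight (s r : ℝ) : ℝ := Real.exp (-r ^ 2 / 2) * r ^ s

lemma gaussWeight_nonneg (s : ℝ) {r : ℝ} (hr : 0 ≤ r) : 0 ≤ gaussWeight s r :=
  mul_nonneg (Real.exp_nonneg _) (Real.rpow_nonneg hr s)

lemma pow_mul_gaussWeight_sub (s : ℝ) {r : ℝ} (hr : 0 < r) (k : ℕ) :
    r ^ k * gaussWeight (s - k) r = gaussWeight s r := by
  rw [gaussWeight, gaussWeight, mul_left_comm, ← Real.rpow_natCast r k, ← Real.rpow_add hr,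
    add_sub_cancel]

lemma measurable_gaussWeight (s : ℝ) : Measurable (gaussWeight s) := by
  unfold gaussWeight
  fun_prop

variable {n : ℕ}

lemma gaussKernel_eq_gaussWeight (q : ℝ) (x : E n) :
    gaussKernel q x = gaussWeight (q - n) ‖x‖ := rfl

lemma gaussKernel_nonneg (q : ℝ) (x : E n) : 0 ≤ gaussKernel q x :=
  gaussWeight_nonneg _ (norm_nonneg x)

lemma measurable_gaussKernel (q : ℝ) : Measurable (gaussKernel q : E n → ℝ) :=
  (measurable_gaussWeight (q - n)).comp measurable_norm

lemma continuous_gaussWeight_inv_gauge (q : ℝ) {K : ConvexBody (E n)}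
    (h0 : (0 : E n) ∈ interior (K : Set (E n))) :
    Continuous fun u : S n => gaussWeight q (gauge (K : Set (E n)) (u : E n))⁻¹ := by
  have hpos (u : S n) := gauge_pos_of_ne_zero h0 (ne_zero_of_mem_unit_sphere u)
  have hρ : Continuous fun u : S n => (gauge (K : Set (E n)) (u : E n))⁻¹ :=
    ((continuous_gauge_body h0).comp continuous_subtype_val).inv₀ fun u => (hpos u).ne'
  exact (Real.continuous_exp.comp ((hρ.pow 2).neg.div_const 2)).mul
    (hρ.rpow_const fun u => .inl (inv_pos.2 (hpos u)).ne')

variable [NeZero n]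

/-- The distance `h_K(ν_K(x))` from the origin to the tangent hyperplane of `K` at a regular
boundary point `x`. -/
noncomputable def tangentDist (K : ConvexBody (E n)) (x : E n) : ℝ :=
  supportFun (K : Set (E n)) (outerNormal (K : Set (E n)) x)

lemma measurable_tangentDist (K : ConvexBody (E n)) : Measurable (tangentDist K) :=
  (continuous_supportFun K).measurable.comp (measurable_outerNormal K)

variable {K : ConvexBody (E n)}

lemma tangentDist_pos (h0 : (0 : E n) ∈ interior (K : Set (E n))) (x : E n) :
    0 < tangentDist K x :=
  supportFun_pos h0 _

lemma coneMeasure_eq_withDensity (h0 : (0 : E n) ∈ interior (K : Set (E n))) :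
    coneMeasure volume K = (μHE[n - 1].restrict (regularBoundary (K : Set (E n)))).withDensity
      fun x => ENNReal.ofReal (tangentDist K x) := by
  have hR := measurableSet_regularBoundary K.isCompact
  have hmap : Measurable fun u : S n => radialMap (K : Set (E n)) (u : E n) :=
    (measurable_radialMap h0).comp measurable_subtype_coe
  have hconc : ∀ᵐ x ∂coneMeasure volume K, x ∈ regularBoundary (K : Set (E n)) :=
    (ae_map_iff hmap.aemeasurable hR).2 <|
      (withDensity_absolutelyContinuous _ _).ae_le (ae_radialMap_mem_regularBoundary h0)
  let w (x : E n) : E n := (tangentDist K x)⁻¹ • (outerNormal (K : Set (E n)) x : E n)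
  have hw : ∀ x ∈ regularBoundary (K : Set (E n)), IsGaugeSubgradient (K : Set (E n)) x (w x) :=
    fun x hx => (isOuterNormal_outerNormal hx).isGaugeSubgradient h0
      (gauge_eq_one_of_mem_regularBoundary h0 hx)
  have hwm : Measurable w :=
    (measurable_tangentDist K).inv.smul (measurable_subtype_coe.comp (measurable_outerNormal K))
  have hnorm (x : E n) : ‖w x‖⁻¹ = tangentDist K x :=
    (congrArg _ (norm_inv_supportFun_smul h0 _)).trans (inv_inv _)
  ext A hA
  rw [← Measure.restrict_eq_self_of_ae_mem hconc, Measure.restrict_apply hA,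
    coneMeasure_eq_setLIntegral h0 (hA.inter hR)
      (fun x hx => gauge_eq_one_of_mem_regularBoundary h0 hx.2) hwm fun x hx => hw x hx.2,
    withDensity_apply _ hA, Measure.restrict_restrict hA, finrank_euclideanSpace_fin]
  simp only [hnorm]

lemma lpGaussDualCurvature_eq_map (p q : ℝ) (K : ConvexBody (E n)) :
    lpGaussDualCurvature p q (K : Set (E n)) =
      ((μHE[n - 1].restrict (regularBoundary (K : Set (E n)))).withDensity fun x =>
        ENNReal.ofReal (tangentDist K x ^ (1 - p) * gaussKernel q x)).map
          (outerNormal (K : Set (E n))) := by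
  have hN := measurable_outerNormal K
  have hdens : Measurable fun x : E n =>
      ENNReal.ofReal (tangentDist K x ^ (1 - p) * gaussKernel q x) :=
    (((measurable_tangentDist K).pow_const _).mul (measurable_gaussKernel q)).ennreal_ofReal
  ext η hη
  have hpre : Subtype.val ⁻¹' (outerNormal (K : Set (E n)) ⁻¹' η) =
      gaussMap (K : Set (E n)) ⁻¹' η := by
    ext x
    simp only [mem_preimage, outerNormal_coe]
  rw [lpGaussDualCurvature_apply p q K hη, Measure.map_apply hN hη, withDensity_apply _ (hN hη),
    ← map_comap_subtype_coe (measurableSet_regularBoundary K.isCompact),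
    setLIntegral_map (hN hη) hdens measurable_subtype_coe, hpre]
  refine lintegral_congr fun x => ?_
  rw [tangentDist, outerNormal_coe, show inner ℝ (x : E n) _ = _ from gaussMap_spec _ x]

lemma lpGaussDualCurvature_eq_withDensity (p q : ℝ)
    (h0 : (0 : E n) ∈ interior (K : Set (E n))) :
    lpGaussDualCurvature p q (K : Set (E n)) =
      (lpGaussDualCurvature 0 q (K : Set (E n))).withDensity
        fun v : S n => ENNReal.ofReal (supportFun (K : Set (E n)) v ^ (-p)) := by
  have hh : Measurable fun v : S n => ENNReal.ofReal (supportFun (K : Set (E n)) v ^ (-p)) :=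
    ((continuous_supportFun K).measurable.pow_const _).ennreal_ofReal
  have ht (s : ℝ) : Measurable fun x => tangentDist K x ^ s :=
    (measurable_tangentDist K).pow_const s
  have hdens : Measurable fun x : E n =>
      ENNReal.ofReal (tangentDist K x ^ (1 - 0 : ℝ) * gaussKernel q x) :=
    ((ht _).mul (measurable_gaussKernel q)).ennreal_ofReal
  rw [lpGaussDualCurvature_eq_map, lpGaussDualCurvature_eq_map,
    withDensity_map _ (measurable_outerNormal K) hh]
  change _ = Measure.map _ (Measure.withDensity _ fun x => ENNReal.ofReal (tangentDist K x ^ (-p)))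
  rw [← withDensity_mul _ hdens (ht _).ennreal_ofReal]
  congr 2 with x
  have hpos := tangentDist_pos h0 x
  rw [Pi.mul_apply, ← ENNReal.ofReal_mul (mul_nonneg (Real.rpow_nonneg hpos.le _)
    (gaussKernel_nonneg q x)), mul_right_comm, ← Real.rpow_add hpos, sub_zero, ← sub_eq_add_neg]

lemma lpGaussDualCurvature_zero_eq_map (q : ℝ) (h0 : (0 : E n) ∈ interior (K : Set (E n))) :
    lpGaussDualCurvature 0 q (K : Set (E n)) =
      ((volume : Measure (E n)).toSphere.withDensity fun u : S n =>
        ENNReal.ofReal (gaussWeight q (gauge (K : Set (E n)) (u : E n))⁻¹)).map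
          fun u : S n => outerNormal (K : Set (E n)) (radialMap (K : Set (E n)) (u : E n)) := by
  have hr : Measurable fun u : S n => radialMap (K : Set (E n)) (u : E n) :=
    (measurable_radialMap h0).comp measurable_subtype_coe
  have hk : Measurable fun x : E n => ENNReal.ofReal (gaussKernel q x) :=
    (measurable_gaussKernel q).ennreal_ofReal
  have hkr : Measurable fun u : S n =>
      ENNReal.ofReal (gaussKernel q (radialMap (K : Set (E n)) (u : E n))) := hk.comp hr
  have hρ : Measurable fun u : S n => (gauge (K : Set (E n)) (u : E n))⁻¹ :=
    ((continuous_gauge_body h0).comp continuous_subtype_val).measurable.inv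
  have hcone : (μHE[n - 1].restrict (regularBoundary (K : Set (E n)))).withDensity (fun x =>
      ENNReal.ofReal (tangentDist K x ^ (1 - 0 : ℝ) * gaussKernel q x)) =
      (coneMeasure volume K).withDensity fun x => ENNReal.ofReal (gaussKernel q x) := by
    rw [coneMeasure_eq_withDensity h0,
      ← withDensity_mul _ (measurable_tangentDist K).ennreal_ofReal hk]
    congr 1 with x
    rw [sub_zero, Real.rpow_one, ENNReal.ofReal_mul (tangentDist_pos h0 x).le, Pi.mul_apply]
  rw [lpGaussDualCurvature_eq_map, hcone, coneMeasure, finrank_euclideanSpace_fin,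
    withDensity_map _ hr hk, ← withDensity_mul _ (hρ.pow_const n).ennreal_ofReal hkr,
    Measure.map_map (measurable_outerNormal K) hr]
  congr 2 with u
  have hpos := inv_pos.2 (gauge_pos_of_ne_zero h0 (ne_zero_of_mem_unit_sphere u))
  have hnorm : ‖radialMap (K : Set (E n)) (u : E n)‖ = (gauge (K : Set (E n)) (u : E n))⁻¹ := by
    rw [radialMap, norm_smul, norm_sphere, mul_one, Real.norm_of_nonneg hpos.le]
  rw [Pi.mul_apply, ← ENNReal.ofReal_mul (pow_nonneg hpos.le n), gaussKernel_eq_gaussWeight, hnorm,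
    pow_mul_gaussWeight_sub _ hpos]

lemma isFiniteMeasure_lpGaussDualCurvature (p q : ℝ)
    (h0 : (0 : E n) ∈ interior (K : Set (E n))) :
    IsFiniteMeasure (lpGaussDualCurvature p q (K : Set (E n))) := by
  have : IsFiniteMeasure (lpGaussDualCurvature 0 q (K : Set (E n))) := by
    rw [lpGaussDualCurvature_zero_eq_map q h0]
    have := isFiniteMeasure_withDensity_of_continuous (μ := (volume : Measure (E n)).toSphere)
      (continuous_gaussWeight_inv_gauge q h0)
    infer_instance
  rw [lpGaussDualCurvature_eq_withDensity p q h0]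
  exact isFiniteMeasure_withDensity_of_continuous <|
    (continuous_supportFun K).rpow_const fun v => .inl (supportFun_pos h0 v).ne'

end CurvatureMeasure

section LogVariation

lemma tendsto_of_tendsto_zero_of_unique_zero {X Y : Type*} [TopologicalSpace X] [CompactSpace X]
    {l : Filter Y} {φ : X → ℝ} (hφ : Continuous φ) {x₀ : X} (huniq : ∀ x, φ x = 0 → x = x₀)
    {w : Y → X} (hw : Tendsto (fun y => φ (w y)) l (𝓝 0)) : Tendsto w l (𝓝 x₀) :=
  tendsto_nhds_of_unique_mapClusterPt fun x hx => huniq x <|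
    eq_of_nhds_neBot <| (hx.continuousAt_comp hφ.continuousAt).clusterPt.mono hw

lemma sub_le_mul_log_sub_log {a b : ℝ} (ha : 0 < a) (hb : 0 < b) :
    a - b ≤ a * (Real.log a - Real.log b) := by
  have h := mul_le_mul_of_nonneg_left (Real.one_sub_inv_le_log_of_pos (div_pos ha hb)) ha.le
  rwa [inv_div, mul_sub, mul_one, mul_div_cancel₀ _ ha.ne', Real.log_div ha.ne' hb.ne'] at h

variable {n : ℕ}

/-- A logarithmic variation of `h 0` with velocity `g`: a family of positive continuous functions
on the sphere, defined for small `t`, with `log (h t) = log (h 0) + t g + o(t)` uniformly. -/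
structure IsLogVariation (h : ℝ → S n → ℝ) (g : S n → ℝ) : Prop where
  eventually_continuous : ∀ᶠ t in 𝓝 0, Continuous (h t)
  eventually_pos : ∀ᶠ t in 𝓝 0, ∀ v, 0 < h t v
  tendstoUniformly :
    TendstoUniformly (fun t v => t⁻¹ * (Real.log (h t v) - Real.log (h 0 v))) g (𝓝[≠] 0)

namespace IsLogVariation

variable {h : ℝ → S n → ℝ} {g : S n → ℝ}

lemma continuous_zero (H : IsLogVariation h g) : Continuous (h 0) :=
  H.eventually_continuous.self_of_nhds

lemma pos_zero (H : IsLogVariation h g) : ∀ v, 0 < h 0 v :=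
  H.eventually_pos.self_of_nhds

lemma continuous_velocity (H : IsLogVariation h g) : Continuous g := by
  refine H.tendstoUniformly.continuous (Eventually.frequently ?_)
  filter_upwards [H.eventually_continuous.filter_mono nhdsWithin_le_nhds,
    H.eventually_pos.filter_mono nhdsWithin_le_nhds] with t htc htpos
  exact continuous_const.mul ((htc.log fun v => (htpos v).ne').sub
    (H.continuous_zero.log fun v => (H.pos_zero v).ne'))

lemma exists_abs_log_sub_le (H : IsLogVariation h g) :
    ∃ M, ∀ᶠ t in 𝓝 0, ∀ v, |Real.log (h t v) - Real.log (h 0 v)| ≤ M * |t| := by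
  obtain ⟨C, hC⟩ := isCompact_univ.exists_bound_of_continuousOn H.continuous_velocity.continuousOn
  refine ⟨1 + C, ?_⟩
  have hclose := Metric.tendstoUniformly_iff.1 H.tendstoUniformly 1 one_pos
  filter_upwards [eventually_nhdsWithin_iff.1 hclose] with t ht v
  rcases eq_or_ne t 0 with rfl | ht0
  · simp
  have hslope : |t⁻¹ * (Real.log (h t v) - Real.log (h 0 v))| ≤ 1 + C := by
    have h1 := ht ht0 v
    have h2 := hC v (mem_univ v)
    rw [dist_comm, Real.dist_eq] at h1
    calc _ ≤ |t⁻¹ * (Real.log (h t v) - Real.log (h 0 v)) - g v| + |g v| :=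
          sub_le_iff_le_add.1 (abs_sub_abs_le_abs_sub _ _)
      _ ≤ 1 + C := add_le_add h1.le h2
  rwa [abs_mul, abs_inv, inv_mul_le_iff₀ (abs_pos.2 ht0), mul_comm] at hslope

lemma exists_abs_log_gauge_sub_le (H : IsLogVariation h g) :
    ∃ M, ∀ᶠ t in 𝓝 0, ∀ y : E n, y ≠ 0 →
      |Real.log (gauge (wulffShape (h t)) y) - Real.log (gauge (wulffShape (h 0)) y)| ≤
        M * |t| := by
  obtain ⟨M, hM⟩ := H.exists_abs_log_sub_le
  refine ⟨M, ?_⟩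
  filter_upwards [hM, H.eventually_continuous, H.eventually_pos] with t ht htc htpos y hy
  obtain ⟨v, hv⟩ := exists_isContact htc htpos hy
  obtain ⟨w, hw⟩ := exists_isContact H.continuous_zero H.pos_zero hy
  have hv' := hv.log_gauge_sub_le htc htpos H.continuous_zero H.pos_zero hy
  have hw' := hw.log_gauge_sub_le H.continuous_zero H.pos_zero htc htpos hy
  exact abs_le.2 ⟨by linarith [(abs_le.1 (ht w)).2], by linarith [(abs_le.1 (ht v)).1]⟩

lemma tendsto_of_isContact (H : IsLogVariation h g) {y : E n} (hy : y ≠ 0) {v₀ : S n}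
    (huniq : ∀ v, IsContact (h 0) y v → v = v₀) {w : ℝ → S n}
    (hw : ∀ᶠ t in 𝓝[≠] 0, IsContact (h t) y (w t)) : Tendsto w (𝓝[≠] 0) (𝓝 v₀) := by
  have hc0 := H.continuous_zero
  have hpos0 := H.pos_zero
  have hG0 := gauge_wulffShape_pos hc0 hpos0 hy
  let φ (v : S n) : ℝ := gauge (wulffShape (h 0)) y * h 0 v - inner ℝ y (v : E n)
  have hφ : Continuous φ := (continuous_const.mul hc0).sub (by fun_prop)
  refine tendsto_of_tendsto_zero_of_unique_zero hφ (fun v hv => huniq v (sub_eq_zero.1 hv).symm) ?_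
  obtain ⟨C, hC⟩ := isCompact_univ.exists_bound_of_continuousOn hc0.continuousOn
  obtain ⟨M, hM⟩ := H.exists_abs_log_sub_le
  obtain ⟨N, hN⟩ := H.exists_abs_log_gauge_sub_le
  refine squeeze_zero' (g := fun t => gauge (wulffShape (h 0)) y * C * (M * |t| + N * |t|))
    (Eventually.of_forall fun t => sub_nonneg.2 (inner_le_gauge_wulffShape_mul hc0 hpos0 y _))
    ?_ (((Continuous.tendsto' (by fun_prop) 0 0 (by simp))).mono_left nhdsWithin_le_nhds)
  filter_upwards [hw, hM.filter_mono nhdsWithin_le_nhds, hN.filter_mono nhdsWithin_le_nhds,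
    H.eventually_continuous.filter_mono nhdsWithin_le_nhds,
    H.eventually_pos.filter_mono nhdsWithin_le_nhds] with t hwt hMt hNt htc htpos
  have hG := gauge_wulffShape_pos htc htpos hy
  have hlog : Real.log (gauge (wulffShape (h 0)) y * h 0 (w t)) -
      Real.log (gauge (wulffShape (h t)) y * h t (w t)) ≤ M * |t| + N * |t| := by
    rw [Real.log_mul hG0.ne' (hpos0 _).ne', Real.log_mul hG.ne' (htpos _).ne']
    linarith [neg_le_of_abs_le (hMt (w t)), neg_le_of_abs_le (hNt y hy)]
  calc gauge (wulffShape (h 0)) y * h 0 (w t) - inner ℝ y (w t : E n)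
      = gauge (wulffShape (h 0)) y * h 0 (w t) - gauge (wulffShape (h t)) y * h t (w t) :=
        congrArg _ hwt
    _ ≤ gauge (wulffShape (h 0)) y * h 0 (w t) *
          (Real.log (gauge (wulffShape (h 0)) y * h 0 (w t)) -
            Real.log (gauge (wulffShape (h t)) y * h t (w t))) :=
        sub_le_mul_log_sub_log (mul_pos hG0 (hpos0 _)) (mul_pos hG (htpos _))
    _ ≤ gauge (wulffShape (h 0)) y * h 0 (w t) * (M * |t| + N * |t|) :=
        mul_le_mul_of_nonneg_left hlog (mul_pos hG0 (hpos0 _)).le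
    _ ≤ gauge (wulffShape (h 0)) y * C * (M * |t| + N * |t|) :=
        mul_le_mul_of_nonneg_right
          (mul_le_mul_of_nonneg_left ((le_abs_self _).trans (hC _ (mem_univ _))) hG0.le)
          (add_nonneg ((abs_nonneg _).trans (hMt (w t))) ((abs_nonneg _).trans (hNt y hy)))

lemma hasDerivAt_log_gauge (H : IsLogVariation h g) {y : E n} (hy : y ≠ 0) {v₀ : S n}
    (huniq : ∀ v, IsContact (h 0) y v → v = v₀) :
    HasDerivAt (fun t => Real.log (gauge (wulffShape (h t)) y)) (-g v₀) 0 := by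
  have hc0 := H.continuous_zero
  have hpos0 := H.pos_zero
  have hc := H.eventually_continuous.filter_mono (nhdsWithin_le_nhds (s := {0}ᶜ))
  have hpos := H.eventually_pos.filter_mono (nhdsWithin_le_nhds (s := {0}ᶜ))
  have hv₀ : IsContact (h 0) y v₀ := by
    obtain ⟨v, hv⟩ := exists_isContact hc0 hpos0 hy
    exact huniq v hv ▸ hv
  have hex : ∀ᶠ t in 𝓝[≠] 0, ∃ v, IsContact (h t) y v := by
    filter_upwards [hc, hpos] with t htc htpos using exists_isContact htc htpos hy
  obtain ⟨w, hw⟩ := hex.choice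
  let L (t : ℝ) (v : S n) : ℝ := t⁻¹ * (Real.log (h t v) - Real.log (h 0 v))
  have hLw : Tendsto (fun t => L t (w t)) (𝓝[≠] 0) (𝓝 (g v₀)) :=
    H.tendstoUniformly.tendsto_comp H.continuous_velocity.continuousAt
      (H.tendsto_of_isContact hy huniq hw)
  have hL : Tendsto (fun t => L t v₀) (𝓝[≠] 0) (𝓝 (g v₀)) := H.tendstoUniformly.tendsto_at v₀
  rw [hasDerivAt_iff_tendsto_slope]
  -- Contact of `h 0` at `v₀` bounds the gauge quotient on one side, contact of `h t` at `w t` on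
  -- the other, so it is within `|L t v₀ - L t (w t)|` of `-L t v₀`.
  have hdiff : Tendsto
      (fun t => slope (fun t => Real.log (gauge (wulffShape (h t)) y)) 0 t + L t v₀)
      (𝓝[≠] 0) (𝓝 0) := by
    refine squeeze_zero_norm' ?_ (by simpa using (hL.sub hLw).abs)
    filter_upwards [hw, hc, hpos] with t hwt htc htpos
    have h1 := hwt.log_gauge_sub_le htc htpos hc0 hpos0 hy
    have h2 := hv₀.log_gauge_sub_le hc0 hpos0 htc htpos hy
    rw [slope_def_module, sub_zero, smul_eq_mul, ← mul_add, ← mul_sub, norm_mul, abs_mul]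
    refine mul_le_mul_of_nonneg_left ?_ (abs_nonneg _)
    rw [Real.norm_of_nonneg (by linarith)]
    exact le_abs_self _ |>.trans' (by linarith)
  simpa using hdiff.sub hL

end IsLogVariation

end LogVariation

section RadialMass

lemma integrableOn_gaussWeight {s : ℝ} (hs : -1 < s) : IntegrableOn (gaussWeight s) (Ioi 0) := by
  refine (integrable_rpow_mul_exp_neg_mul_sq one_half_pos hs).integrableOn.congr_fun
    (fun r _ => ?_) measurableSet_Ioi
  rw [gaussWeight, mul_comm]
  ring_nf

lemma intervalIntegrable_gaussWeight {s : ℝ} (hs : -1 < s) {b : ℝ} (hb : 0 ≤ b) :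
    IntervalIntegrable (gaussWeight s) volume 0 b :=
  (intervalIntegrable_iff_integrableOn_Ioc_of_le hb).2
    ((integrableOn_gaussWeight hs).mono_set Ioc_subset_Ioi_self)

lemma continuousAt_gaussWeight (s : ℝ) {r : ℝ} (hr : 0 < r) : ContinuousAt (gaussWeight s) r := by
  have hpow := Real.continuousAt_rpow_const r s (.inl hr.ne')
  unfold gaussWeight
  fun_prop

/-- The Gaussian mass of a radial segment of length `exp s`. The logarithmic variable makes it
Lipschitz on the whole line, with derivative `gaussWeight q (exp s)`. -/
noncomputable def logGaussMass (q s : ℝ) : ℝ := ∫ r in 0..Real.exp s, gaussWeight (q - 1) r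

variable {q : ℝ}

lemma hasDerivAt_logGaussMass (hq : 0 < q) (s : ℝ) :
    HasDerivAt (logGaussMass q) (gaussWeight q (Real.exp s)) s := by
  have hmass := intervalIntegral.integral_hasDerivAt_right
    (intervalIntegrable_gaussWeight (by linarith : -1 < q - 1) (Real.exp_nonneg s))
    (measurable_gaussWeight _).stronglyMeasurable.stronglyMeasurableAtFilter
    (continuousAt_gaussWeight _ (Real.exp_pos s))
  have hexp := hmass.comp s (Real.hasDerivAt_exp s)
  have hweight := pow_mul_gaussWeight_sub q (Real.exp_pos s) 1
  rw [pow_one, Nat.cast_one, mul_comm] at hweight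
  exact hweight ▸ hexp

lemma continuous_logGaussMass (hq : 0 < q) : Continuous (logGaussMass q) :=
  continuous_iff_continuousAt.2 fun s => (hasDerivAt_logGaussMass hq s).continuousAt

lemma gaussWeight_le (hq : 0 < q) {r : ℝ} (hr : 0 < r) :
    gaussWeight q r ≤ Real.exp (q / 2 * (Real.log q - 1)) := by
  rw [gaussWeight, Real.rpow_def_of_pos hr, ← Real.exp_add, Real.exp_le_exp]
  have hlog := Real.log_le_sub_one_of_pos (show 0 < r ^ 2 / q by positivity)
  rw [Real.log_div (by positivity) hq.ne', Real.log_pow, le_sub_iff_add_le, le_div_iff₀ hq] at hlog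
  push_cast at hlog
  linarith

lemma abs_logGaussMass_sub_le (hq : 0 < q) (a b : ℝ) :
    |logGaussMass q b - logGaussMass q a| ≤ Real.exp (q / 2 * (Real.log q - 1)) * |b - a| :=
  convex_univ.norm_image_sub_le_of_norm_hasDerivWithin_le
    (fun s _ => (hasDerivAt_logGaussMass hq s).hasDerivWithinAt)
    (fun s _ => (Real.norm_of_nonneg (gaussWeight_nonneg q (Real.exp_nonneg s))).trans_le
      (gaussWeight_le hq (Real.exp_pos s)))
    (mem_univ a) (mem_univ b)

lemma logGaussMass_nonneg (q s : ℝ) : 0 ≤ logGaussMass q s :=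
  intervalIntegral.integral_nonneg (Real.exp_nonneg s) fun _ hr => gaussWeight_nonneg _ hr.1

lemma ofReal_logGaussMass (hq : 0 < q) (s : ℝ) :
    ENNReal.ofReal (logGaussMass q s) =
      ∫⁻ r in Ioo 0 (Real.exp s), ENNReal.ofReal (gaussWeight (q - 1) r) := by
  rw [logGaussMass, intervalIntegral.integral_of_le (Real.exp_nonneg s),
    integral_Ioc_eq_integral_Ioo]
  exact ofReal_integral_eq_lintegral_ofReal
    ((integrableOn_gaussWeight (by linarith)).mono_set Ioo_subset_Ioi_self)
    (ae_restrict_of_forall_mem measurableSet_Ioo fun r hr => gaussWeight_nonneg _ hr.1.le)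

end RadialMass

section PolarFormula

variable {n : ℕ} {q : ℝ}

lemma continuous_log_gauge {L : ConvexBody (E n)} (h0 : (0 : E n) ∈ interior (L : Set (E n))) :
    Continuous fun u : S n => Real.log (gauge (L : Set (E n)) (u : E n)) :=
  ((continuous_gauge_body h0).comp continuous_subtype_val).log fun u =>
    (gauge_pos_of_ne_zero h0 (ne_zero_of_mem_unit_sphere u)).ne'

variable [NeZero n]

lemma integrable_gaussKernel (hq : 0 < q) : Integrable (gaussKernel q : E n → ℝ) := by
  refine (integrable_fun_norm_addHaar volume (f := gaussWeight (q - n))).2 ?_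
  refine (integrableOn_gaussWeight (by linarith : -1 < q - 1)).congr_fun (fun r hr => ?_)
    measurableSet_Ioi
  rw [finrank_euclideanSpace_fin, smul_eq_mul, ← pow_mul_gaussWeight_sub (q - 1) hr (n - 1),
    Nat.cast_pred (NeZero.pos n), sub_sub_sub_cancel_right]

lemma setLIntegral_gaussKernel (hq : 0 < q) {L : ConvexBody (E n)}
    (h0 : (0 : E n) ∈ interior (L : Set (E n))) :
    ∫⁻ x in (L : Set (E n)), ENNReal.ofReal (gaussKernel q x) = ∫⁻ u : S n, ENNReal.ofReal
      (logGaussMass q (-Real.log (gauge (L : Set (E n)) (u : E n))))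
        ∂(volume : Measure (E n)).toSphere := by
  rw [← setLIntegral_congr (interior_ae_eq_of_null_frontier (L.convex.addHaar_frontier volume)),
    ← setOfPred_gauge_lt_one_eq_interior L.convex (mem_interior_iff_mem_nhds.1 h0),
    setLIntegral_gauge_lt_one volume h0 (measurable_gaussKernel q).ennreal_ofReal]
  refine lintegral_congr fun u => ?_
  have hg := gauge_pos_of_ne_zero h0 (ne_zero_of_mem_unit_sphere u)
  rw [ofReal_logGaussMass hq, Real.exp_neg, Real.exp_log hg]
  refine setLIntegral_congr_fun measurableSet_Ioo fun r hr => ?_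
  rw [← ENNReal.ofReal_mul (pow_nonneg hr.1.le _), gaussKernel_eq_gaussWeight, norm_smul,
    norm_sphere, mul_one, Real.norm_of_nonneg hr.1.le, finrank_euclideanSpace_fin,
    ← pow_mul_gaussWeight_sub (q - 1) hr.1 (n - 1), Nat.cast_pred (NeZero.pos n),
    sub_sub_sub_cancel_right]

lemma gaussDualQuermass_eq_integral_toSphere (hq : 0 < q) {L : ConvexBody (E n)}
    (h0 : (0 : E n) ∈ interior (L : Set (E n))) :
    gaussDualQuermass q (L : Set (E n)) = ∫ u : S n,
      logGaussMass q (-Real.log (gauge (L : Set (E n)) (u : E n)))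
        ∂(volume : Measure (E n)).toSphere := by
  have hcont : Continuous fun u : S n =>
      logGaussMass q (-Real.log (gauge (L : Set (E n)) (u : E n))) :=
    (continuous_logGaussMass hq).comp (continuous_log_gauge h0).neg
  rw [gaussDualQuermass, integral_eq_lintegral_of_nonneg_ae
      (.of_forall (gaussKernel_nonneg q)) (measurable_gaussKernel q).aestronglyMeasurable,
    integral_eq_lintegral_of_nonneg_ae (.of_forall fun u => logGaussMass_nonneg q _)
      hcont.aestronglyMeasurable, setLIntegral_gaussKernel hq h0]

end PolarFormula

section VariationalFormula

lemma hasDerivAt_integral_of_norm_sub_le {X F : Type*} [MeasurableSpace X] {μ : Measure X}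
    [NormedAddCommGroup F] [NormedSpace ℝ F] {Φ : ℝ → X → F} {Φ' : X → F} {bound : X → ℝ} {t₀ : ℝ}
    (hmeas : ∀ᶠ t in 𝓝 t₀, AEStronglyMeasurable (Φ t) μ) (hint : Integrable (Φ t₀) μ)
    (hmeas' : AEStronglyMeasurable Φ' μ)
    (hlip : ∀ᶠ t in 𝓝 t₀, ∀ x, ‖Φ t x - Φ t₀ x‖ ≤ bound x * ‖t - t₀‖)
    (hbound : Integrable bound μ) (hderiv : ∀ᵐ x ∂μ, HasDerivAt (Φ · x) (Φ' x) t₀) :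
    HasDerivAt (fun t => ∫ x, Φ t x ∂μ) (∫ x, Φ' x ∂μ) t₀ := by
  obtain ⟨hint', hfderiv⟩ := hasFDerivAt_integral_of_dominated_loc_of_lip' (𝕜 := ℝ)
    (F' := fun x => ContinuousLinearMap.toSpanSingleton ℝ (Φ' x))
    (hmeas.and hlip) (fun t ht => ht.1) hint
    (ContinuousLinearMap.toSpanSingletonCLE.continuous.comp_aestronglyMeasurable hmeas')
    (.of_forall fun x t ht => ht.2 x) hbound (hderiv.mono fun x hx => hx.hasFDerivAt)
  simpa [ContinuousLinearMap.integral_apply hint'] using hfderiv.hasDerivAt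

variable {n : ℕ} [NeZero n] {q : ℝ} {K : ConvexBody (E n)}

lemma measurable_outerNormal_radialMap (h0 : (0 : E n) ∈ interior (K : Set (E n))) :
    Measurable fun u : S n => outerNormal (K : Set (E n)) (radialMap K (u : E n)) :=
  (measurable_outerNormal K).comp ((measurable_radialMap h0).comp measurable_subtype_coe)

lemma integral_lpGaussDualCurvature_zero (q : ℝ) (h0 : (0 : E n) ∈ interior (K : Set (E n)))
    {g : S n → ℝ} (hg : Continuous g) :
    ∫ v, g v ∂(lpGaussDualCurvature 0 q (K : Set (E n))) =
      ∫ u : S n, gaussWeight q (gauge (K : Set (E n)) (u : E n))⁻¹ *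
        g (outerNormal (K : Set (E n)) (radialMap K (u : E n)))
          ∂(volume : Measure (E n)).toSphere := by
  rw [lpGaussDualCurvature_zero_eq_map q h0,
    integral_map (measurable_outerNormal_radialMap h0).aemeasurable hg.aestronglyMeasurable,
    integral_withDensity_eq_integral_toReal_smul
      (continuous_gaussWeight_inv_gauge q h0).measurable.ennreal_ofReal
      (.of_forall fun u => ENNReal.ofReal_lt_top)]
  refine integral_congr_ae (.of_forall fun u => ?_)
  simp only [smul_eq_mul]
  rw [ENNReal.toReal_ofReal (gaussWeight_nonneg q (inv_nonneg.2 (gauge_nonneg _)))]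

namespace IsLogVariation

variable {h : ℝ → S n → ℝ} {g : S n → ℝ}

lemma ae_hasDerivAt_logGaussMass (H : IsLogVariation h g) (hq : 0 < q)
    (h0 : (0 : E n) ∈ interior (K : Set (E n)))
    (hK : h 0 = fun v : S n => supportFun (K : Set (E n)) (v : E n)) :
    ∀ᵐ u : S n ∂(volume : Measure (E n)).toSphere,
      HasDerivAt (fun t => logGaussMass q (-Real.log (gauge (wulffShape (h t)) (u : E n))))
        (gaussWeight q (gauge (K : Set (E n)) (u : E n))⁻¹ *
          g (outerNormal (K : Set (E n)) (radialMap K (u : E n)))) 0 := by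
  filter_upwards [ae_radialMap_mem_regularBoundary h0] with u hu
  have hu0 : (u : E n) ≠ 0 := ne_zero_of_mem_unit_sphere u
  have huniq (v : S n) (hv : IsContact (h 0) (u : E n) v) :
      v = outerNormal (K : Set (E n)) (radialMap K (u : E n)) :=
    ((isContact_supportFun_iff h0 hu0).1 (hK ▸ hv)).eq_outerNormal hu
  have hderiv := (hasDerivAt_logGaussMass hq _).comp 0 (H.hasDerivAt_log_gauge hu0 huniq).fun_neg
  simpa only [Function.comp_def, neg_neg, hK, wulffShape_supportFun, Real.exp_neg,
    Real.exp_log (gauge_pos_of_ne_zero h0 hu0)] using hderiv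

theorem hasDerivAt_gaussDualQuermass (H : IsLogVariation h g) (hq : 0 < q)
    (h0 : (0 : E n) ∈ interior (K : Set (E n)))
    (hK : h 0 = fun v : S n => supportFun (K : Set (E n)) (v : E n)) :
    HasDerivAt (fun t => gaussDualQuermass q (wulffShape (h t)))
      (∫ v, g v ∂(lpGaussDualCurvature 0 q (K : Set (E n)))) 0 := by
  have hbody {t : ℝ} (hc : Continuous (h t)) (hpos : ∀ v, 0 < h t v) :
      (0 : E n) ∈ interior (wulffBody (h t) hc hpos : Set (E n)) :=
    zero_mem_interior_wulffShape hc hpos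
  have hcont {t : ℝ} (hc : Continuous (h t)) (hpos : ∀ v, 0 < h t v) :
      Continuous fun u : S n => logGaussMass q (-Real.log (gauge (wulffShape (h t)) (u : E n))) :=
    (continuous_logGaussMass hq).comp (continuous_log_gauge (hbody hc hpos)).neg
  have hpolar : ∀ᶠ t in 𝓝 0, gaussDualQuermass q (wulffShape (h t)) =
      ∫ u : S n, logGaussMass q (-Real.log (gauge (wulffShape (h t)) (u : E n)))
        ∂(volume : Measure (E n)).toSphere := by
    filter_upwards [H.eventually_continuous, H.eventually_pos] with t hc hpos
    exact gaussDualQuermass_eq_integral_toSphere hq (hbody hc hpos)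
  obtain ⟨M, hM⟩ := H.exists_abs_log_gauge_sub_le
  rw [integral_lpGaussDualCurvature_zero q h0 H.continuous_velocity]
  refine (hasDerivAt_integral_of_norm_sub_le
    (bound := fun _ => Real.exp (q / 2 * (Real.log q - 1)) * M) ?_ ?_ ?_ ?_ (integrable_const _)
    (H.ae_hasDerivAt_logGaussMass hq h0 hK)).congr_of_eventuallyEq hpolar
  · filter_upwards [H.eventually_continuous, H.eventually_pos] with t hc hpos
    exact (hcont hc hpos).aestronglyMeasurable
  · exact (hcont H.continuous_zero H.pos_zero).integrable_of_hasCompactSupport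
      (HasCompactSupport.of_compactSpace _)
  · exact ((continuous_gaussWeight_inv_gauge q h0).measurable.mul
      (H.continuous_velocity.measurable.comp
        (measurable_outerNormal_radialMap h0))).aestronglyMeasurable
  · filter_upwards [hM] with t ht u
    refine (abs_logGaussMass_sub_le hq _ _).trans ?_
    rw [mul_assoc, neg_sub_neg, abs_sub_comm, sub_zero, Real.norm_eq_abs]
    exact mul_le_mul_of_nonneg_left (ht u (ne_zero_of_mem_unit_sphere u)) (Real.exp_nonneg _)

end IsLogVariation

end VariationalFormula

section LpPerturbation

lemma abs_log_one_add_sub_le {x : ℝ} (hx : |x| ≤ 1 / 2) : |Real.log (1 + x) - x| ≤ 2 * x ^ 2 := by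
  have hx1 : |-x| < 1 := (abs_neg x).trans_lt (hx.trans_lt one_half_lt_one)
  have htaylor := Real.abs_log_sub_add_sum_range_le hx1 1
  simp only [Finset.sum_range_one, Nat.cast_zero, zero_add, pow_one, div_one, sub_neg_eq_add,
    abs_neg, sq_abs, one_add_one_eq_two, neg_add_eq_sub] at htaylor
  refine htaylor.trans ((div_le_iff₀ (by linarith)).2 ?_)
  nlinarith [sq_nonneg x]

lemma tendstoUniformly_inv_mul_log_one_add {X : Type*} {r : X → ℝ} {R : ℝ} (hr : ∀ x, |r x| ≤ R) :
    TendstoUniformly (fun t x => t⁻¹ * Real.log (1 + t * r x)) r (𝓝[≠] 0) := by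
  have hbound : Tendsto (fun t : ℝ => 2 * R ^ 2 * |t|) (𝓝[≠] 0) (𝓝 0) :=
    (Continuous.tendsto' (by fun_prop) 0 0 (by simp)).mono_left nhdsWithin_le_nhds
  have hsmall : Tendsto (fun t : ℝ => |t| * R) (𝓝[≠] 0) (𝓝 0) :=
    (Continuous.tendsto' (by fun_prop) 0 0 (by simp)).mono_left nhdsWithin_le_nhds
  refine Metric.tendstoUniformly_iff.2 fun ε hε => ?_
  filter_upwards [hbound.eventually_lt_const hε, hsmall.eventually_le_const one_half_pos,
    self_mem_nhdsWithin] with t htε htR ht0 x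
  have hmul : |t * r x| ≤ |t| * R :=
    (abs_mul t _).trans_le (mul_le_mul_of_nonneg_left (hr x) (abs_nonneg t))
  have ht : 0 < |t| := abs_pos.2 ht0
  calc dist (r x) (t⁻¹ * Real.log (1 + t * r x))
      = |t|⁻¹ * |Real.log (1 + t * r x) - t * r x| := by
        rw [dist_comm, Real.dist_eq, ← abs_inv, ← abs_mul, mul_sub, inv_mul_cancel_left₀ ht0]
    _ ≤ |t|⁻¹ * (2 * (|t| * R) ^ 2) := by
        gcongr
        refine (abs_log_one_add_sub_le (hmul.trans htR)).trans ?_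
        rw [← sq_abs]
        gcongr
    _ = 2 * R ^ 2 * |t| := by field_simp
    _ < ε := htε

lemma eventually_forall_add_mul_pos {X : Type*} [TopologicalSpace X] [CompactSpace X]
    {a b : X → ℝ} (ha : Continuous a) (hb : Continuous b) (hpos : ∀ x, 0 < a x) :
    ∀ᶠ t in 𝓝 0, ∀ x, 0 < a x + t * b x := by
  have hopen : IsOpen {z : ℝ × X | 0 < a z.2 + z.1 * b z.2} :=
    isOpen_lt continuous_const (by fun_prop)
  have hcompact := isCompact_univ.eventually_forall_of_forall_eventually (x₀ := (0 : ℝ))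
    (P := fun t x => 0 < a x + t * b x) fun x _ => hopen.mem_nhds (by simpa using hpos x)
  simpa only [mem_univ, forall_true_left] using hcompact

variable {n : ℕ} {p : ℝ} {K : ConvexBody (E n)} {f : S n → ℝ}

lemma eventually_lpPerturbation_base_pos (h0 : (0 : E n) ∈ interior (K : Set (E n)))
    (hf : Continuous fun v => f v ^ p) :
    ∀ᶠ t in 𝓝 0, ∀ v : S n, 0 < supportFun (K : Set (E n)) (v : E n) ^ p + t * f v ^ p :=
  eventually_forall_add_mul_pos
    ((continuous_supportFun K).rpow_const fun v => .inl (supportFun_pos h0 v).ne') hf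
    fun v => Real.rpow_pos_of_pos (supportFun_pos h0 v) p

lemma lpPerturbation_zero (hp : p ≠ 0) (h0 : (0 : E n) ∈ interior (K : Set (E n))) :
    lpPerturbation p (K : Set (E n)) f 0 = fun v : S n => supportFun (K : Set (E n)) (v : E n) := by
  funext v
  rw [lpPerturbation, zero_mul, add_zero, one_div,
    Real.rpow_rpow_inv (supportFun_pos h0 v).le hp]

lemma continuous_lpPerturbation (h0 : (0 : E n) ∈ interior (K : Set (E n)))
    (hf : Continuous fun v => f v ^ p) {t : ℝ}
    (hpos : ∀ v : S n, 0 < supportFun (K : Set (E n)) (v : E n) ^ p + t * f v ^ p) :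
    Continuous (lpPerturbation p (K : Set (E n)) f t) :=
  Continuous.rpow_const (((continuous_supportFun K).rpow_const fun v =>
    .inl (supportFun_pos h0 v).ne').add (continuous_const.mul hf)) fun v => .inl (hpos v).ne'

lemma log_lpPerturbation_sub (hp : p ≠ 0) (h0 : (0 : E n) ∈ interior (K : Set (E n))) {t : ℝ}
    {v : S n} (hpos : 0 < supportFun (K : Set (E n)) (v : E n) ^ p + t * f v ^ p) :
    Real.log (lpPerturbation p (K : Set (E n)) f t v) -
        Real.log (lpPerturbation p (K : Set (E n)) f 0 v) =
      1 / p * Real.log (1 + t * (f v ^ p * supportFun (K : Set (E n)) (v : E n) ^ (-p))) := by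
  have hv := supportFun_pos h0 v
  have ha := Real.rpow_pos_of_pos hv p
  have hratio : 1 + t * (f v ^ p * supportFun (K : Set (E n)) (v : E n) ^ (-p)) =
      (supportFun (K : Set (E n)) (v : E n) ^ p + t * f v ^ p) /
        supportFun (K : Set (E n)) (v : E n) ^ p := by
    rw [Real.rpow_neg hv.le]
    field_simp
  rw [lpPerturbation_zero hp h0, lpPerturbation, Real.log_rpow hpos, hratio,
    Real.log_div hpos.ne' ha.ne', Real.log_rpow hv]
  field_simp

lemma isLogVariation_lpPerturbation (hp : p ≠ 0) (h0 : (0 : E n) ∈ interior (K : Set (E n)))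
    (hf : Continuous fun v => f v ^ p) :
    IsLogVariation (lpPerturbation p (K : Set (E n)) f)
      fun v : S n => 1 / p * (f v ^ p * supportFun (K : Set (E n)) (v : E n) ^ (-p)) where
  eventually_continuous := (eventually_lpPerturbation_base_pos h0 hf).mono fun _ hpos =>
    continuous_lpPerturbation h0 hf hpos
  eventually_pos := (eventually_lpPerturbation_base_pos h0 hf).mono fun _ hpos v =>
    Real.rpow_pos_of_pos (hpos v) _
  tendstoUniformly := by
    have hratio : Continuous fun v : S n => f v ^ p * supportFun (K : Set (E n)) (v : E n) ^ (-p) :=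
      hf.mul ((continuous_supportFun K).rpow_const fun v => .inl (supportFun_pos h0 v).ne')
    obtain ⟨R, hR⟩ := isCompact_univ.exists_bound_of_continuousOn hratio.continuousOn
    have hlog := tendstoUniformly_inv_mul_log_one_add fun v => hR v (mem_univ v)
    refine (tendstoUniformly_congr ?_).1
      ((uniformContinuous_const_smul (1 / p)).comp_tendstoUniformly hlog)
    filter_upwards [(eventually_lpPerturbation_base_pos h0 hf).filter_mono nhdsWithin_le_nhds]
      with t hpos
    funext v
    rw [log_lpPerturbation_sub hp h0 (hpos v), mul_left_comm]
    rfl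

variable [NeZero n] {q : ℝ}

lemma integrable_lpGaussDualCurvature (p q : ℝ) (h0 : (0 : E n) ∈ interior (K : Set (E n)))
    {g : S n → ℝ} (hg : Continuous g) :
    Integrable g (lpGaussDualCurvature p q (K : Set (E n))) :=
  haveI := isFiniteMeasure_lpGaussDualCurvature p q h0
  hg.integrable_of_hasCompactSupport (HasCompactSupport.of_compactSpace g)

lemma integral_lpGaussDualCurvature (p q : ℝ) (h0 : (0 : E n) ∈ interior (K : Set (E n)))
    (g : S n → ℝ) :
    ∫ v, g v ∂(lpGaussDualCurvature p q (K : Set (E n))) =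
      ∫ v : S n, g v * supportFun (K : Set (E n)) (v : E n) ^ (-p)
        ∂(lpGaussDualCurvature 0 q (K : Set (E n))) := by
  have hdens : Measurable fun v : S n =>
      ENNReal.ofReal (supportFun (K : Set (E n)) (v : E n) ^ (-p)) :=
    ((continuous_supportFun K).measurable.pow_const _).ennreal_ofReal
  rw [lpGaussDualCurvature_eq_withDensity p q h0, integral_withDensity_eq_integral_toReal_smul
    hdens (.of_forall fun v => ENNReal.ofReal_lt_top)]
  refine integral_congr_ae (.of_forall fun v => ?_)
  simp only [smul_eq_mul]
  rw [ENNReal.toReal_ofReal (Real.rpow_nonneg (supportFun_pos h0 v).le _), mul_comm]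

theorem hasDerivAt_gaussDualQuermass_lpPerturbation (hp : p ≠ 0) (hq : 0 < q)
    (h0 : (0 : E n) ∈ interior (K : Set (E n))) (hf : Continuous fun v => f v ^ p) :
    HasDerivAt (fun t => gaussDualQuermass q (wulffShape (lpPerturbation p (K : Set (E n)) f t)))
      (1 / p * ∫ v, f v ^ p ∂(lpGaussDualCurvature p q (K : Set (E n)))) 0 := by
  rw [integral_lpGaussDualCurvature p q h0, ← integral_const_mul]
  exact (isLogVariation_lpPerturbation hp h0 hf).hasDerivAt_gaussDualQuermass hq h0
    (lpPerturbation_zero hp h0)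

end LpPerturbation

end GaussDual

theorem theorem3p1_general {n : ℕ} [NeZero n] {p q : ℝ} (hp : p ≠ 0) (hq : 0 < q)
    {K : ConvexBody (GaussDual.E n)}
    (hK : (0 : GaussDual.E n) ∈ interior (K : Set (GaussDual.E n)))
    {f : GaussDual.S n → ℝ} (hf : Continuous f) (hfp : ∀ v, f v ≠ 0 ∨ 0 ≤ p) :
    (∃ δ : ℝ, 0 < δ ∧ ∀ t ∈ Ioo (-δ) δ,
      (∀ v : GaussDual.S n,
        0 < GaussDual.supportFun (K : Set (GaussDual.E n)) v ^ p + t * f v ^ p) ∧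
      (∃ L : ConvexBody (GaussDual.E n),
        (L : Set (GaussDual.E n)) =
          GaussDual.wulffShape (GaussDual.lpPerturbation p (K : Set (GaussDual.E n)) f t) ∧
        (0 : GaussDual.E n) ∈ interior (L : Set (GaussDual.E n)) ∧
        IntegrableOn (GaussDual.gaussKernel q) (L : Set (GaussDual.E n)))) ∧
    IntegrableOn (GaussDual.gaussKernel q) (K : Set (GaussDual.E n)) ∧
    Integrable (fun v => f v ^ p)
      (GaussDual.lpGaussDualCurvature p q (K : Set (GaussDual.E n))) ∧
    Tendsto
      (fun t : ℝ =>
        (GaussDual.gaussDualQuermass q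
            (GaussDual.wulffShape (GaussDual.lpPerturbation p (K : Set (GaussDual.E n)) f t)) -
          GaussDual.gaussDualQuermass q (K : Set (GaussDual.E n))) / t)
      (𝓝[≠] 0)
      (𝓝 (1 / p * ∫ v, f v ^ p
        ∂(GaussDual.lpGaussDualCurvature p q (K : Set (GaussDual.E n))))) := by
  have hfpow : Continuous fun v => f v ^ p := hf.rpow_const hfp
  have hkernel := GaussDual.integrable_gaussKernel (n := n) hq
  refine ⟨?_, hkernel.integrableOn, GaussDual.integrable_lpGaussDualCurvature p q hK hfpow, ?_⟩
  · obtain ⟨δ, hδ, hpos⟩ := Metric.eventually_nhds_iff.1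
      (GaussDual.eventually_lpPerturbation_base_pos hK hfpow)
    refine ⟨δ, hδ, fun t ht => ?_⟩
    have hpos_t := hpos (y := t) (by rwa [Real.dist_0_eq_abs, abs_lt])
    have hcont := GaussDual.continuous_lpPerturbation hK hfpow hpos_t
    have hh_t (v) := Real.rpow_pos_of_pos (hpos_t v) (1 / p)
    exact ⟨hpos_t, GaussDual.wulffBody _ hcont hh_t, rfl,
      GaussDual.zero_mem_interior_wulffShape hcont hh_t, hkernel.integrableOn⟩
  · refine (GaussDual.hasDerivAt_gaussDualQuermass_lpPerturbation hp hq hK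
      hfpow).tendsto_slope.congr fun t => ?_
    rw [slope_def_field, sub_zero, GaussDual.lpPerturbation_zero hp hK,
      GaussDual.wulffShape_supportFun]

theorem theorem3p1 (n : ℕ) (hn : 1 ≤ n) (p q : ℝ) (hp : 1 < p) (hq : 1 < q)
    (K : ConvexBody (GaussDual.E n)) (hK : (0 : GaussDual.E n) ∈ interior (K : Set (GaussDual.E n)))
    (f : GaussDual.S n → ℝ) (hf : Continuous f) :
    -- for small `|t|` the function `h_t` is well defined and positive, and its Wulff shape is a
    -- convex body with the origin in its interior and with finite quermassintegral
    (∃ δ : ℝ, 0 < δ ∧ ∀ t ∈ Set.Ioo (-δ) δ,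
      (∀ v : GaussDual.S n, 0 < GaussDual.supportFun (K : Set (GaussDual.E n)) v ^ p + t * f v ^ p) ∧
      (∃ L : ConvexBody (GaussDual.E n),
        (L : Set (GaussDual.E n)) =
          GaussDual.wulffShape (GaussDual.lpPerturbation p (K : Set (GaussDual.E n)) f t) ∧
        (0 : GaussDual.E n) ∈ interior (L : Set (GaussDual.E n)) ∧
        MeasureTheory.IntegrableOn (GaussDual.gaussKernel q) (L : Set (GaussDual.E n)))) ∧
    MeasureTheory.IntegrableOn (GaussDual.gaussKernel q) (K : Set (GaussDual.E n)) ∧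
    MeasureTheory.Integrable (fun v => f v ^ p)
      (GaussDual.lpGaussDualCurvature p q (K : Set (GaussDual.E n))) ∧
    -- the variational formula
    Filter.Tendsto
      (fun t : ℝ =>
        (GaussDual.gaussDualQuermass q
            (GaussDual.wulffShape (GaussDual.lpPerturbation p (K : Set (GaussDual.E n)) f t)) -
          GaussDual.gaussDualQuermass q (K : Set (GaussDual.E n))) / t)
      (nhdsWithin 0 {0}ᶜ)
      (nhds (1 / p * ∫ v, f v ^ p
        ∂(GaussDual.lpGaussDualCurvature p q (K : Set (GaussDual.E n))))) :=
  haveI : NeZero n := ⟨by omega⟩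
  theorem3p1_general (by linarith) (by linarith) hK hf fun _ => .inr (by linarith)
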